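/- **Theorem 3.8 (multidimensional Itô formula).** Let $T>0$, $n\in\mathbb N$, and let $X=(X^1,\dots,X^n)$, $X^k=(X^k_t)_{t\in[0,T]}$, be real-valued stochastic processes on a probability space such that * $X^1,\dots,X^n$ are independent (as processes); * for every $k$, almost every path of $X^k$ is Hölder continuous on $[0,T]$ of order $\alpha_k$, and $\min_k\alpha_k>\tfrac12$; * for every $k$ there is $g_k\in L^1([0,T])$ such that for almost every $t\in[0,T]$ the random variable $X^k_t$ has a density $p^k_t$ with $\sup_y p^k_t(y)\le g_k(t)$. Let $f:\mathbb R^n\to\mathbb R$ be continuous in each variable separately. Assume that for every $k$ the left-sided partial derivative $$\partial_k^-f(x)=\lim_{h\downarrow0}\frac{f(x)-f(x-he_k)}{h}$$ exists at every $x\in\mathbb R^n$, and that it is of locally bounded variation in each variable: for every $R>0$ there is $C<\infty$ such that for every $j$ and every $x\in[-R,R]^n$ the function $u\mapsto\partial_k^-f(x_1,\dots,x_{j-1},u,x_{j+1},\dots,x_n)$ has total variation at most $C$ on $[-R,R]$. Then, almost surely, all the generalized Lebesgue–Stieltjes integrals $\int_0^T\partial_k^-f(X_t)\,\mathrm dX^k_t$,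 $k=1,\dots,n$, exist and $$f(X_T)=f(X_0)+\sum_{k=1}^n\int_0^T\partial_k^-f(X^1_t,\dots,X^n_t)\,\mathrm dX^k_t .$$ Here, for $0<\beta<1$ and measurable $h,g:[0,T]\to\mathbb R$, we write $h\in W_2^\beta$ if $$\int_0^T\frac{|h(s)|}{s^\beta}\,\mathrm ds+\int_0^T\!\int_0^s\frac{|h(s)-h(u)|}{(s-u)^{1+\beta}}\,\mathrm du\,\mathrm ds<\infty,$$ and $g\in W_1^{1-\beta}$ if $$\sup_{0\le s<t\le T}\Big(\frac{|g(t)-g(s)|}{(t-s)^{1-\beta}}+\int_s^t\frac{|g(u)-g(s)|}{(u-s)^{2-\beta}}\,\mathrm du\Big)<\infty .$$ For $h\in W_2^\beta$ and $g\in W_1^{1-\beta}$ the generalized Lebesgue–Stieltjes integral is the Lebesgue integral $$\int_0^T h\,\mathrm dg=-\int_0^T A(s)B(s)\,\mathrm ds,$$ $$A(s)=\frac1{\Gamma(1-\beta)}\Big(\frac{h(s)}{s^\beta}+\beta\int_0^s\frac{h(s)-h(u)}{(s-u)^{1+\beta}}\,\mathrm du\Big),$$ $$B(s)=\frac1{\Gamma(\beta)}\Big(\frac{g(s)-g(T)}{(T-s)^{1-\beta}}+(1-\beta)\int_s^T\frac{g(s)-g(u)}{(u-s)^{2-\beta}}\,\mathrm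 du\Big).$$ Existence of the $k$-th integral means that, for every $\beta\in(0,1)$ with $1-\alpha_k<\beta<\min_j\alpha_j$, one has $\partial_k^-f(X_\cdot)\in W_2^\beta$ and $X^k\in W_1^{1-\beta}$, the product $AB$ is Lebesgue integrable on $[0,T]$, and the value of the integral is the same for all such $\beta$. -/

import Mathlib

open MeasureTheory ProbabilityTheory
open scoped NNReal ENNReal

noncomputable section

/-- Membership in the fractional Besov space `W₁^β([0,T])`: measurability on `[0,T]` together with
finiteness of
`sup_{0 ≤ s < t ≤ T} ( |f t - f s| / (t-s)^β + ∫_s^t |f u - f s| / (u-s)^(1+β) du )`. -/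
def MemBesovOne (T β : ℝ) (f : ℝ → ℝ) : Prop :=
  Measurable (fun t : Set.Icc (0 : ℝ) T => f t) ∧
    (⨆ (s : ℝ) (t : ℝ) (_ : 0 ≤ s ∧ s < t ∧ t ≤ T),
      (ENNReal.ofReal (|f t - f s| / (t - s) ^ β) +
        ∫⁻ u in Set.Ioo s t, ENNReal.ofReal (|f u - f s| / (u - s) ^ (1 + β)))) < ∞

/-- Membership in the fractional Besov space `W₂^β([0,T])`: measurability on `[0,T]` together with
finiteness of
`∫_0^T |f s| / s^β ds + ∫_0^T ∫_0^s |f s - f u| / (s-u)^(1+β) du ds`. -/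
def MemBesovTwo (T β : ℝ) (f : ℝ → ℝ) : Prop :=
  Measurable (fun t : Set.Icc (0 : ℝ) T => f t) ∧
    (∫⁻ s in Set.Ioo 0 T, ENNReal.ofReal (|f s| / s ^ β)) +
      (∫⁻ s in Set.Ioo 0 T, ∫⁻ u in Set.Ioo 0 s,
        ENNReal.ofReal (|f s - f u| / (s - u) ^ (1 + β))) < ∞

/-- The Weyl form of the left-sided fractional derivative `D^β_{0+} f`. -/
def weylLeft (β : ℝ) (f : ℝ → ℝ) (s : ℝ) : ℝ :=
  1 / Real.Gamma (1 - β) *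
    (f s / s ^ β + β * ∫ u in (0 : ℝ)..s, (f s - f u) / (s - u) ^ (β + 1))

/-- The Weyl form of the right-sided fractional derivative `D^β_{t-} g`, without its unimodular
constant (a complex power of `-1`), which is accounted for in `glsIntegral`. -/
def weylRight (β t : ℝ) (g : ℝ → ℝ) (s : ℝ) : ℝ :=
  1 / Real.Gamma (1 - β) *
    (g s / (t - s) ^ β + β * ∫ u in s..t, (g s - g u) / (u - s) ^ (β + 1))

/-- The integrand `s ↦ (D^β_{0+} f)(s) (D^{1-β}_{t-} g_{t-})(s)`, up to sign, where
`g_{t-} = g - g(t-)`; every `g` in `W₁^{1-β}` is continuous, so that `g(t-) = g(t)`. -/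
def glsIntegrand (t β : ℝ) (f g : ℝ → ℝ) (s : ℝ) : ℝ :=
  weylLeft β f s * weylRight (1 - β) t (fun r => g r - g t) s

/-- The generalized Lebesgue--Stieltjes integral `∫_0^t f dg`, computed with the exponent `β`.
The powers of `-1` in the usual formula
`(-1)^β ∫_0^t (D^β_{0+} f)(s) (D^{1-β}_{t-} g_{t-})(s) ds` multiply to `-1`, which is the sign in
front here; with it `∫_0^t 1 dg = g t - g 0`. -/
def glsIntegral (t β : ℝ) (f g : ℝ → ℝ) : ℝ :=
  -∫ s in (0 : ℝ)..t, glsIntegrand t β f g s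

/-- `∫_0^T f dg` exists in the generalized Lebesgue--Stieltjes sense with exponent `β`, and its
value is `I`. -/
structure HasGLSIntegral (T β : ℝ) (f g : ℝ → ℝ) (I : ℝ) : Prop where
  mem_integrand : MemBesovTwo T β f
  mem_integrator : MemBesovOne T (1 - β) g
  integrable : IntervalIntegrable (glsIntegrand T β f g) volume 0 T
  value : glsIntegral T β f g = I

/-- For almost every `t ∈ [0,T]` the random variable `X t` has a density, and this density is
(essentially) bounded by `g t`, for some `g ∈ L¹([0,T])`. -/
def HasIntegrablyBoundedDensities {Ω : Type*} [MeasurableSpace Ω] (P : Measure Ω) (T : ℝ)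
    (X : ℝ → Ω → ℝ) : Prop :=
  ∃ g : ℝ → ℝ, IntegrableOn g (Set.Icc 0 T) ∧
    ∀ᵐ t ∂(volume.restrict (Set.Icc 0 T)),
      HasPDF (X t) P volume ∧ ∀ᵐ y ∂(volume : Measure ℝ), pdf (X t) P volume y ≤ ENNReal.ofReal (g t)

/-- The left-sided partial derivative of `f` in the `k`-th variable exists at `x`, with value `d`. -/
def HasLeftPartialDeriv {n : ℕ} (f : (Fin n → ℝ) → ℝ) (k : Fin n) (x : Fin n → ℝ) (d : ℝ) : Prop :=
  HasDerivWithinAt (fun u => f (Function.update x k u)) d (Set.Iic (x k)) (x k)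

/-- `h` is of locally bounded variation in each variable: on every cube `[-R,R]^n`, the variation of
`h` over the segments of the cube parallel to the axes is bounded. -/
def LocallyBVInEachVariable {n : ℕ} (h : (Fin n → ℝ) → ℝ) : Prop :=
  ∀ R : ℝ, ∃ C : ℝ≥0, ∀ (j : Fin n) (x : Fin n → ℝ), (∀ i, x i ∈ Set.Icc (-R) R) →
    eVariationOn (fun u => h (Function.update x j u)) (Set.Icc (-R) R) ≤ C

end

open Set Filter Topology

/-! Divide the first order expansion f(X_{s+δ}) - f(X_s) = Σ_k ∂_k^- f(X_s) (X^k_{s+δ} - X^k_s) +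
remainder by δ and integrate over s in [0,T]. As δ → 0 the left side tends to f(X_T) - f(X_0),
because f is in fact jointly continuous. It remains to see that each forward integral tends to the
generalized Lebesgue–Stieltjes integral and that the remainder disappears.

The first point is deterministic (`MemBesovTwo.tendsto_forwardIntegral`). The quotient (g(s+δ) -
g(s))/δ is the derivative of a Steklov average of g. For an integrator with bounded derivative, the
generalized integral is the ordinary one: h in W_2^β is the fractional integral of its Weyl
derivative (`MemBesovTwo.fractionalIntegral_weylLeft`), and Fubini moves that fractional integral to
the other factor. Steklov averages keep the Hölder constant of g, so dominated convergence passes to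
g itself. The forward integrals do not mention β, so neither does their limit.

The second point is probabilistic. A function of variation at most C changes within distance η of y
by at most some D(y) with ∫ D ≤ 2ηC (`exists_window_bound`). At a random point with density at most
c this has mean at most 2ηCc, whatever the joint law of the process at two times. Independence
freezes the other coordinates, so changing one coordinate at a time gives a mean increment O(η) for
∂_k^- f(X) and a mean Taylor remainder O(η²), on the event that the path lies in a cube and moves by
at most η.

With η = N δ^α the remainder divided by δ is O(δ^{2α-1}), which is summable along δ = 2^{-m} since α
> 1/2, so it tends to zero almost surely (`ae_tendsto_lintegral_taylor`). With η = N (s-u)^α the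
increment bound, integrated against (s-u)^{-1-β}, puts ∂_k^- f(X) in W_2^β for β < α
(`ae_lintegral_increment_lt_top`). Almost every path satisfies the constraints for some integer N,
so countably many N suffice. -/

/-! ### Volterra kernels, power integrals and the beta integral. -/

theorem intervalIntegral_eq_setIntegral_Ioo {a b : ℝ} (hab : a ≤ b) (G : ℝ → ℝ) :
    ∫ t in a..b, G t = ∫ t in Ioo a b, G t := by
  rw [intervalIntegral.integral_of_le hab, integral_Ioc_eq_integral_Ioo]

theorem setIntegral_Ioo_ite_lt_left {b s : ℝ} (hs : s ∈ Ioo 0 b) (G : ℝ → ℝ) :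
    ∫ t in Ioo 0 b, (if s < t then G t else 0) = ∫ t in s..b, G t := by
  have : (fun t => if s < t then G t else 0) = indicator (Ioi s) G := by
    ext t; simp [indicator]
  rw [this, setIntegral_indicator measurableSet_Ioi,
    intervalIntegral_eq_setIntegral_Ioo hs.2.le]
  congr 2
  ext t; simp only [mem_inter_iff, mem_Ioo, mem_Ioi]
  exact ⟨fun h => ⟨h.2, h.1.2⟩, fun h => ⟨⟨hs.1.trans h.1, h.2⟩, h.1⟩⟩

theorem setIntegral_Ioo_ite_lt_right {b t : ℝ} (ht : t ∈ Ioo 0 b) (G : ℝ → ℝ) :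
    ∫ s in Ioo 0 b, (if s < t then G s else 0) = ∫ s in 0..t, G s := by
  have : (fun s => if s < t then G s else 0) = indicator (Iio t) G := by
    ext t; simp [indicator]
  rw [this, setIntegral_indicator measurableSet_Iio,
    intervalIntegral_eq_setIntegral_Ioo ht.1.le]
  congr 2
  ext s; simp only [mem_inter_iff, mem_Ioo, mem_Iio]
  exact ⟨fun h => ⟨h.1.1, h.2⟩, fun h => ⟨⟨h.1, h.2.trans ht.2⟩, h.2⟩⟩

/-- Fubini's theorem for a Volterra kernel acting on an integrable function. -/
theorem volterra_swap {b M : ℝ} (hb : 0 ≤ b) {a : ℝ → ℝ} {K : ℝ → ℝ → ℝ}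
    (ha : IntervalIntegrable a volume 0 b) (hK : Measurable (Function.uncurry K))
    (hKint : ∀ s ∈ Ioo 0 b, IntervalIntegrable (fun t => K t s) volume s b)
    (hKM : ∀ s ∈ Ioo 0 b, ∫ t in s..b, |K t s| ≤ M) :
    (∀ᵐ t, t ∈ Ioo 0 b → IntervalIntegrable (fun s => K t s * a s) volume 0 t) ∧
    IntervalIntegrable (fun t => ∫ s in 0..t, K t s * a s) volume 0 b ∧
    ∫ t in 0..b, ∫ s in 0..t, K t s * a s = ∫ s in 0..b, a s * ∫ t in s..b, K t s := by
  set μ : Measure ℝ := volume.restrict (Ioo 0 b) with hμ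
  have ha' : Integrable a μ := by
    rw [intervalIntegrable_iff_integrableOn_Ioo_of_le hb] at ha; exact ha
  -- Extension by zero from the triangle to the square, so that Fubini applies to a product measure;
  -- the absolute integral of `F` is at most `M` times that of `a`.
  let F : ℝ × ℝ → ℝ := fun p => if p.1 < p.2 then K p.2 p.1 * a p.1 else 0
  have hFm : AEStronglyMeasurable F (μ.prod μ) := by
    have h1 : AEStronglyMeasurable (fun p : ℝ × ℝ => K p.2 p.1 * a p.1) (μ.prod μ) :=
      ((hK.comp measurable_swap).aestronglyMeasurable).mul ha'.1.comp_fst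
    have := h1.indicator (s := {p : ℝ × ℝ | p.1 < p.2}) (measurableSet_lt measurable_fst measurable_snd)
    refine this.congr (Eventually.of_forall fun p => ?_)
    simp [F, indicator]
  have hin : ∀ᵐ s ∂μ, s ∈ Ioo 0 b := ae_restrict_mem measurableSet_Ioo
  have hF : Integrable F (μ.prod μ) := by
    rw [integrable_prod_iff hFm]
    constructor
    · filter_upwards [hin] with s hs
      have h1 := (intervalIntegrable_iff_integrableOn_Ioo_of_le hs.2.le).1 (hKint s hs)
      have : (fun t => F (s, t)) = indicator (Ioi s) (fun t => K t s * a s) := by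
        ext t; simp [F, indicator]
      rw [this, integrable_indicator_iff measurableSet_Ioi, IntegrableOn, hμ,
        Measure.restrict_restrict measurableSet_Ioi]
      refine (IntegrableOn.mono_set (h1.mul_const (a s)) ?_)
      rintro t ⟨h1, h2⟩
      exact ⟨h1, h2.2⟩
    · refine Integrable.mono' (ha'.norm.const_mul M) hFm.norm.integral_prod_right' ?_
      filter_upwards [hin] with s hs
      have h1 : ∀ t, ‖F (s, t)‖ = if s < t then |K t s| * |a s| else 0 := by
        intro t; simp only [F]; split_ifs <;> simp
      simp only [h1]
      rw [Real.norm_of_nonneg (integral_nonneg fun t => by dsimp only; split_ifs <;> positivity),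
        setIntegral_Ioo_ite_lt_left hs fun t => |K t s| * |a s|, intervalIntegral.integral_mul_const]
      exact mul_le_mul_of_nonneg_right (hKM s hs) (abs_nonneg _)
  have hrow : ∀ t ∈ Ioo 0 b, ∫ s, F (s, t) ∂μ = ∫ s in 0..t, K t s * a s := fun t ht =>
    setIntegral_Ioo_ite_lt_right ht fun s => K t s * a s
  have hcol : ∀ s ∈ Ioo 0 b, ∫ t, F (s, t) ∂μ = a s * ∫ t in s..b, K t s := by
    intro s hs
    rw [setIntegral_Ioo_ite_lt_left hs fun t => K t s * a s, intervalIntegral.integral_mul_const,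
      mul_comm]
  refine ⟨?_, ?_, ?_⟩
  · have := hF.prod_left_ae
    rw [hμ, ae_restrict_iff' measurableSet_Ioo] at this
    filter_upwards [this] with t ht htb
    rw [intervalIntegrable_iff_integrableOn_Ioo_of_le htb.1.le]
    have h1 := ht htb
    have h2 : (fun s => F (s, t)) = indicator (Iio t) (fun s => K t s * a s) := by
      ext t; simp [F, indicator]
    rw [h2, integrable_indicator_iff measurableSet_Iio, IntegrableOn,
        Measure.restrict_restrict measurableSet_Iio] at h1
    refine IntegrableOn.mono_set h1 ?_
    rintro s ⟨h3, h4⟩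
    exact ⟨h4, h3, h4.trans htb.2⟩
  · rw [intervalIntegrable_iff_integrableOn_Ioo_of_le hb]
    refine (hF.integral_prod_right).congr ?_
    filter_upwards [hin] with t ht using hrow t ht
  · rw [intervalIntegral_eq_setIntegral_Ioo hb, intervalIntegral_eq_setIntegral_Ioo hb,
      ← setIntegral_congr_fun measurableSet_Ioo hrow, ← setIntegral_congr_fun measurableSet_Ioo hcol]
    exact (integral_integral_swap (f := fun s t => F (s, t)) hF).symm

/-- Euler's beta integral with exponents adding up to 1, so that the power of x - s drops out. This
independence of s and x is why fractional integrals of orders β and 1 - β compose to plain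
integration. -/
theorem integral_rpow_mul_rpow_eq_gamma {β s x : ℝ} (h0 : 0 < β) (h1 : β < 1) (hsx : s < x) :
    ∫ t in s..x, (x - t) ^ (β - 1) * (t - s) ^ (-β) = Real.Gamma β * Real.Gamma (1 - β) := by
  have ha : 0 < x - s := sub_pos.2 hsx
  have key := Complex.betaIntegral_scaled (1 - β : ℝ) (β : ℝ) ha
  have h2 : (∫ y in 0..(x - s), (x - s - y) ^ (β - 1) * y ^ (-β) : ℝ) =
      Real.Gamma β * Real.Gamma (1 - β) := by
    have hl : ∫ y in (0:ℝ)..(x - s), (y : ℂ) ^ (((1 - β : ℝ) : ℂ) - 1) *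
        (((x - s : ℝ) : ℂ) - y) ^ ((β : ℂ) - 1) =
        ((∫ y in 0..(x - s), (x - s - y) ^ (β - 1) * y ^ (-β) : ℝ) : ℂ) := by
      rw [← intervalIntegral.integral_ofReal]
      rw [intervalIntegral.integral_of_le ha.le, intervalIntegral.integral_of_le ha.le]
      refine setIntegral_congr_fun measurableSet_Ioc fun y hy => ?_
      rw [Complex.ofReal_mul, Complex.ofReal_cpow (by linarith [hy.2]), Complex.ofReal_cpow hy.1.le,
        mul_comm]
      push_cast
      congr 2
      ring
    rw [hl, Complex.betaIntegral_eq_Gamma_mul_div _ _ (by simpa using h1) (by simpa using h0)] at key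
    have e : ((1 - β : ℝ) : ℂ) + (β : ℂ) = 1 := by push_cast; ring
    rw [e, Complex.Gamma_one, Complex.Gamma_ofReal, Complex.Gamma_ofReal, sub_self,
      Complex.cpow_zero, one_mul, div_one] at key
    rw [mul_comm (Real.Gamma β)]
    exact_mod_cast key
  rw [← h2, ← sub_self s, ← intervalIntegral.integral_comp_sub_right
    (fun y => (x - s - y) ^ (β - 1) * y ^ (-β)) s]
  congr 1; ext t; congr 2; ring

theorem intervalIntegrable_rpow_mul_rpow {β s x : ℝ} (h0 : 0 < β) (h1 : β < 1) (hsx : s < x) :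
    IntervalIntegrable (fun t => (x - t) ^ (β - 1) * (t - s) ^ (-β)) volume s x := by
  -- The integral of a non-integrable function is 0 by convention, so a nonzero value certifies
  -- integrability.
  apply intervalIntegral.intervalIntegrable_of_integral_ne_zero
  rw [integral_rpow_mul_rpow_eq_gamma h0 h1 hsx]
  exact mul_ne_zero (Real.Gamma_pos_of_pos h0).ne' (Real.Gamma_pos_of_pos (by linarith)).ne'

theorem intervalIntegrable_sub_rpow {p : ℝ} (hp : -1 < p) (s a b : ℝ) :
    IntervalIntegrable (fun t => (t - s) ^ p) volume a b := by
  have := (intervalIntegral.intervalIntegrable_rpow' (a := a - s) (b := b - s) hp).comp_sub_right s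
  simpa using this

theorem intervalIntegrable_sub_rpow' {p : ℝ} (hp : -1 < p) (s a b : ℝ) :
    IntervalIntegrable (fun t => (s - t) ^ p) volume a b := by
  have := (intervalIntegral.intervalIntegrable_rpow' (a := s - a) (b := s - b) hp).comp_sub_left s
  simpa using this

theorem integral_sub_rpow {p : ℝ} (hp : -1 < p) (s x : ℝ) :
    ∫ t in s..x, (t - s) ^ p = (x - s) ^ (p + 1) / (p + 1) := by
  rw [intervalIntegral.integral_comp_sub_right (fun t => t ^ p) s, sub_self,
    integral_rpow (Or.inl hp), Real.zero_rpow (by linarith), sub_zero]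

theorem integral_sub_rpow' {p : ℝ} (hp : -1 < p) (s x : ℝ) :
    ∫ t in s..x, (x - t) ^ p = (x - s) ^ (p + 1) / (p + 1) := by
  rw [intervalIntegral.integral_comp_sub_left (fun t => t ^ p) x, sub_self,
    integral_rpow (Or.inl hp), Real.zero_rpow (by linarith), sub_zero]

/-- The kernel of the Weyl derivative is not integrable at the diagonal; the shift by ε makes it
integrable, at the price of a term ε^(-β) that later cancels. -/
theorem integral_shifted_rpow {β ε s x : ℝ} (hβ : 0 < β) (hε : 0 < ε) (hsx : s ≤ x) :
    ∫ t in s..x, (t - s + ε) ^ (-(β + 1)) = (ε ^ (-β) - (x - s + ε) ^ (-β)) / β := by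
  have : ∫ t in s..x, (t - s + ε) ^ (-(β + 1)) = ∫ t in s..x, (t - (s - ε)) ^ (-(β + 1)) := by
    congr 1; ext t; congr 1; ring
  rw [this, intervalIntegral.integral_comp_sub_right (fun t => t ^ (-(β + 1))) (s - ε),
    integral_rpow]
  · rw [show -(β + 1) + 1 = -β by ring, show s - (s - ε) = ε by ring,
      show x - (s - ε) = x - s + ε by ring]
    field_simp; ring
  · right
    refine ⟨by linarith, ?_⟩
    rw [uIcc_of_le (by linarith)]
    intro h; linarith [h.1]

theorem integral_shifted_rpow' {β ε s x : ℝ} (hβ : 0 < β) (hε : 0 < ε) (hsx : s ≤ x) :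
    ∫ t in s..x, (x - t + ε) ^ (-(β + 1)) = (ε ^ (-β) - (x - s + ε) ^ (-β)) / β := by
  rw [← integral_shifted_rpow hβ hε hsx]
  have h := intervalIntegral.integral_comp_sub_left (a := s) (b := x)
    (fun t => (t - s + ε) ^ (-(β + 1))) (x + s)
  rw [show x + s - x = s by ring, show x + s - s = x by ring] at h
  rw [← h]
  congr 1; ext t; congr 1; ring

theorem intervalIntegrable_shifted_rpow {p ε s x : ℝ} (hε : 0 < ε) (hsx : s ≤ x) :
    IntervalIntegrable (fun t => (t - s + ε) ^ p) volume s x := by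
  refine ContinuousOn.intervalIntegrable fun t ht => ?_
  rw [uIcc_of_le hsx] at ht
  exact (ContinuousAt.rpow_const (by fun_prop) (Or.inl (by linarith [ht.1]))).continuousWithinAt

/-- Fractional integration of the fractional integral of complementary order. -/
theorem integral_rpow_mul_integral_rpow_neg {β x : ℝ} (h0 : 0 < β) (h1 : β < 1) (hx : 0 ≤ x)
    {h : ℝ → ℝ} (hh : IntervalIntegrable h volume 0 x) :
    ∫ t in 0..x, (x - t) ^ (β - 1) * ∫ s in 0..t, (t - s) ^ (-β) * h s =
      Real.Gamma β * Real.Gamma (1 - β) * ∫ s in 0..x, h s := by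
  have key := (volterra_swap (M := Real.Gamma β * Real.Gamma (1 - β)) hx hh
    (K := fun t s => (x - t) ^ (β - 1) * (t - s) ^ (-β)) (by
      unfold Function.uncurry; fun_prop)
    (fun s hs => intervalIntegrable_rpow_mul_rpow h0 h1 hs.2) (fun s hs => by
      rw [← integral_rpow_mul_rpow_eq_gamma h0 h1 hs.2]
      refine (intervalIntegral.integral_congr fun t ht => ?_).le
      rw [uIcc_of_le hs.2.le] at ht
      exact abs_of_nonneg (mul_nonneg (Real.rpow_nonneg (by linarith [ht.2]) _)
        (Real.rpow_nonneg (by linarith [ht.1]) _)))).2.2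
  simp_rw [mul_assoc, intervalIntegral.integral_const_mul] at key
  rw [key, ← intervalIntegral.integral_const_mul]
  rw [intervalIntegral_eq_setIntegral_Ioo hx, intervalIntegral_eq_setIntegral_Ioo hx]
  refine setIntegral_congr_fun measurableSet_Ioo fun s hs => ?_
  rw [integral_rpow_mul_rpow_eq_gamma h0 h1 hs.2, mul_comm]

theorem volterra_swap_rpow {p x : ℝ} (hp : -1 < p) (hx : 0 ≤ x) {a ψ : ℝ → ℝ}
    (ha : IntervalIntegrable a volume 0 x) (hψ : Measurable ψ) {C : ℝ} (hC : ∀ t, |ψ t| ≤ C) :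
    (∀ᵐ t, t ∈ Ioo 0 x → IntervalIntegrable (fun s => ψ t * (t - s) ^ p * a s) volume 0 t) ∧
    IntervalIntegrable (fun t => ∫ s in 0..t, ψ t * (t - s) ^ p * a s) volume 0 x ∧
    ∫ t in 0..x, ∫ s in 0..t, ψ t * (t - s) ^ p * a s =
      ∫ s in 0..x, a s * ∫ t in s..x, ψ t * (t - s) ^ p := by
  have hC0 : 0 ≤ C := (abs_nonneg _).trans (hC 0)
  have hii : ∀ s, IntervalIntegrable (fun t => ψ t * (t - s) ^ p) volume s x := by
    intro s
    refine ((intervalIntegrable_sub_rpow hp s s x).norm.const_mul C).mono_fun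
      (by fun_prop) (Eventually.of_forall fun t => ?_)
    simp only [norm_mul, norm_norm]
    exact mul_le_mul_of_nonneg_right ((hC t).trans (le_abs_self C)) (norm_nonneg _)
  refine volterra_swap (M := C * (x ^ (p + 1) / (p + 1))) hx ha
    (K := fun t s => ψ t * (t - s) ^ p) (by unfold Function.uncurry; fun_prop)
    (fun s _ => hii s) fun s hs => ?_
  calc ∫ t in s..x, |ψ t * (t - s) ^ p| ≤ ∫ t in s..x, C * (t - s) ^ p := by
        refine intervalIntegral.integral_mono_on hs.2.le (hii s).abs
          ((intervalIntegrable_sub_rpow hp s s x).const_mul C) fun t ht => ?_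
        rw [abs_mul, abs_of_nonneg (Real.rpow_nonneg (sub_nonneg.2 ht.1) p)]
        exact mul_le_mul_of_nonneg_right (hC t) (Real.rpow_nonneg (sub_nonneg.2 ht.1) p)
    _ = C * ((x - s) ^ (p + 1) / (p + 1)) := by
        rw [intervalIntegral.integral_const_mul, integral_sub_rpow hp]
    _ ≤ _ := by
        have : 0 ≤ p + 1 := by linarith
        gcongr
        · linarith [hs.2]
        · linarith [hs.1]

/-! ### Left Weyl derivatives and their inversion. -/

/-- The difference quotient kernel of the left Weyl derivative, set to zero off the triangle. -/
noncomputable def weylKernel (β : ℝ) (h : ℝ → ℝ) (p : ℝ × ℝ) : ℝ :=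
  if p.2 < p.1 then (h p.1 - h p.2) / (p.1 - p.2) ^ (β + 1) else 0

theorem measurable_weylKernel {β : ℝ} {h : ℝ → ℝ} (hm : Measurable h) :
    Measurable (weylKernel β h) := by
  unfold weylKernel
  exact Measurable.ite (measurableSet_lt measurable_snd measurable_fst) (by fun_prop)
    measurable_const

theorem MemBesovTwo.integrableOn_weylKernel {T β : ℝ} {h : ℝ → ℝ} (hm : Measurable h)
    (hh : MemBesovTwo T β h) :
    IntegrableOn (weylKernel β h) (Ioo 0 T ×ˢ Ioo 0 T) (volume.prod volume) := by
  rw [IntegrableOn, ← Measure.prod_restrict]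
  refine ⟨(measurable_weylKernel hm).aestronglyMeasurable, ?_⟩
  rw [HasFiniteIntegral, lintegral_prod _ (measurable_weylKernel hm).enorm.aemeasurable]
  refine lt_of_le_of_lt ?_ ((le_add_self.trans_lt hh.2 : _))
  refine setLIntegral_mono' measurableSet_Ioo fun s hs => ?_
  have : (fun u => ‖weylKernel β h (s, u)‖ₑ) ≤ indicator (Iio s)
      (fun u => ENNReal.ofReal (|h s - h u| / (s - u) ^ (1 + β))) := by
    intro u
    by_cases hu : u < s
    · simp only [weylKernel, hu, if_true, indicator, mem_Iio]
      rw [Real.enorm_eq_ofReal_abs, abs_div, abs_of_nonneg (Real.rpow_nonneg (by linarith) _),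
        add_comm β]
    · simp [weylKernel, hu]
  refine (lintegral_mono this).trans ?_
  rw [lintegral_indicator measurableSet_Iio, Measure.restrict_restrict measurableSet_Iio]
  exact lintegral_mono_set fun u hu => ⟨hu.2.1, hu.1⟩

theorem MemBesovTwo.intervalIntegrable_rpow_neg_mul {T β : ℝ} (hT : 0 ≤ T) {h : ℝ → ℝ} (hm : Measurable h)
    (hh : MemBesovTwo T β h) :
    IntervalIntegrable (fun s => s ^ (-β) * h s) volume 0 T := by
  rw [intervalIntegrable_iff_integrableOn_Ioo_of_le hT]
  refine ⟨by fun_prop, ?_⟩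
  refine lt_of_le_of_lt ?_ ((le_self_add.trans_lt hh.2 : _))
  refine setLIntegral_mono' measurableSet_Ioo fun s hs => ?_
  rw [Real.enorm_eq_ofReal_abs, abs_mul, abs_of_nonneg (Real.rpow_nonneg hs.1.le _),
    Real.rpow_neg hs.1.le, div_eq_inv_mul]

theorem MemBesovTwo.intervalIntegrable {T β : ℝ} (hT : 0 ≤ T) (hβ : 0 ≤ β) {h : ℝ → ℝ} (hm : Measurable h)
    (hh : MemBesovTwo T β h) : IntervalIntegrable h volume 0 T := by
  have h1 := hh.intervalIntegrable_rpow_neg_mul hT hm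
  rw [intervalIntegrable_iff_integrableOn_Ioo_of_le hT] at h1 ⊢
  refine Integrable.mono' (h1.norm.const_mul (T ^ β)) (by fun_prop) ?_
  filter_upwards [ae_restrict_mem measurableSet_Ioo] with s hs
  rw [norm_mul, ← mul_assoc, Real.norm_of_nonneg (Real.rpow_nonneg hs.1.le _)]
  refine le_mul_of_one_le_left (norm_nonneg _) ?_
  rw [Real.rpow_neg hs.1.le, ← div_eq_mul_inv, one_le_div (Real.rpow_pos_of_pos hs.1 _)]
  exact Real.rpow_le_rpow hs.1.le hs.2.le hβ

theorem integral_weylKernel {T β s : ℝ} (hs : s ∈ Ioo 0 T) (h : ℝ → ℝ) :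
    ∫ u in Ioo 0 T, weylKernel β h (s, u) = ∫ u in 0..s, (h s - h u) / (s - u) ^ (β + 1) :=
  setIntegral_Ioo_ite_lt_right hs fun u => (h s - h u) / (s - u) ^ (β + 1)

theorem MemBesovTwo.intervalIntegrable_weylLeft {T β : ℝ} (hT : 0 ≤ T) {h : ℝ → ℝ}
    (hm : Measurable h) (hh : MemBesovTwo T β h) :
    IntervalIntegrable (weylLeft β h) volume 0 T := by
  have h1 := hh.intervalIntegrable_rpow_neg_mul hT hm
  have h2 := hh.integrableOn_weylKernel hm
  rw [IntegrableOn, ← Measure.prod_restrict] at h2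
  rw [intervalIntegrable_iff_integrableOn_Ioo_of_le hT] at h1 ⊢
  refine ((h1.add (h2.integral_prod_left.const_mul β)).const_mul (1 / Real.Gamma (1 - β))).congr ?_
  filter_upwards [ae_restrict_mem measurableSet_Ioo] with s hs
  simp only [Pi.add_apply]
  rw [integral_weylKernel hs, weylLeft, Real.rpow_neg hs.1.le, div_eq_inv_mul (h s)]

/-- The primitive of the left Weyl derivative is the fractional integral of order `1 - β`. -/
theorem MemBesovTwo.integral_weylLeft {T β : ℝ} (h0 : 0 < β) (h1 : β < 1) (hT : 0 < T) {h : ℝ → ℝ}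
    (hm : Measurable h) (hh : MemBesovTwo T β h) :
    ∀ᵐ t, t ∈ Ioo 0 T → Real.Gamma (1 - β) * ∫ s in 0..t, weylLeft β h s =
      ∫ s in 0..t, (t - s) ^ (-β) * h s := by
  have hI := hh.intervalIntegrable hT.le h0.le hm
  have hIβ := hh.intervalIntegrable_rpow_neg_mul hT.le hm
  have hKT := hh.integrableOn_weylKernel hm
  have hΓ : Real.Gamma (1 - β) ≠ 0 := (Real.Gamma_pos_of_pos (by linarith)).ne'
  -- The admissible t are those for which (t - s)^(-β) h(s) is integrable in s; Fubini provides
  -- almost all of them.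
  filter_upwards [(volterra_swap_rpow (p := -β) (by linarith) hT.le hI (ψ := fun _ => 1)
    measurable_const (C := 1) (by simp)).1] with t ht' htT
  have ht := ht' htT
  simp only [one_mul] at ht
  have ht0 := htT.1
  have hsub : uIcc 0 t ⊆ uIcc 0 T := by
    rw [uIcc_of_le ht0.le, uIcc_of_le hT.le]; exact Icc_subset_Icc_right htT.2.le
  have hIt := hI.mono_set hsub
  have hIβt := hIβ.mono_set hsub
  have hK : Integrable (weylKernel β h) ((volume.restrict (Ioo 0 t)).prod
      (volume.restrict (Ioo 0 t))) := by
    rw [Measure.prod_restrict]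
    refine hKT.mono_set (prod_mono ?_ ?_) <;> exact Ioo_subset_Ioo_right htT.2.le
  -- The halves h(s) and h(u) of the difference cannot be integrated separately against the singular
  -- kernel. With the shift they can, and since `Kε` is dominated by `weylKernel`, the limit ε → 0
  -- is harmless.
  let Kε : ℝ → ℝ × ℝ → ℝ := fun ε p =>
    if p.2 < p.1 then (h p.1 - h p.2) * (p.1 - p.2 + ε) ^ (-(β + 1)) else 0
  have hKεm : ∀ ε, Measurable (Kε ε) := fun ε =>
    Measurable.ite (measurableSet_lt measurable_snd measurable_fst) (by fun_prop) measurable_const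
  have hKεb : ∀ ε, 0 < ε → ∀ p, ‖Kε ε p‖ ≤ ‖weylKernel β h p‖ := by
    intro ε hε p
    by_cases hp : p.2 < p.1
    · have hp' : 0 < p.1 - p.2 := sub_pos.2 hp
      simp only [Kε, weylKernel, hp, if_true]
      rw [norm_mul, div_eq_mul_inv, norm_mul, ← Real.rpow_neg hp'.le,
        Real.norm_of_nonneg (Real.rpow_nonneg hp'.le _),
        Real.norm_of_nonneg (Real.rpow_nonneg (by linarith) _)]
      refine mul_le_mul_of_nonneg_left ?_ (norm_nonneg _)
      exact Real.rpow_le_rpow_of_nonpos hp' (by linarith) (by linarith)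
    · simp [Kε, weylKernel, hp]
  have hKεi : ∀ ε, 0 < ε → Integrable (Kε ε) ((volume.restrict (Ioo 0 t)).prod
      (volume.restrict (Ioo 0 t))) := fun ε hε =>
    hK.mono (hKεm ε).aestronglyMeasurable (Eventually.of_forall (hKεb ε hε))
  let e : ℕ → ℝ := fun n => 1 / ((n : ℝ) + 1)
  have he : ∀ n, 0 < e n := fun n => Nat.one_div_pos_of_nat
  have hlim : Tendsto e atTop (𝓝 0) := tendsto_one_div_add_atTop_nhds_zero_nat
  have hshift : ∀ x : ℝ, 0 < x → ∀ p : ℝ, Tendsto (fun n => (x + e n) ^ p) atTop (𝓝 (x ^ p)) := by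
    intro x hx p
    have : Tendsto (fun n => x + e n) atTop (𝓝 (x + 0)) := hlim.const_add x
    rw [add_zero] at this
    exact this.rpow_const (Or.inl hx.ne')
  have hconv1 : Tendsto (fun n => ∫ p, Kε (e n) p ∂((volume.restrict (Ioo 0 t)).prod
      (volume.restrict (Ioo 0 t)))) atTop (𝓝 (∫ p, weylKernel β h p
        ∂((volume.restrict (Ioo 0 t)).prod (volume.restrict (Ioo 0 t))))) := by
    refine tendsto_integral_of_dominated_convergence _
      (fun n => (hKεm (e n)).aestronglyMeasurable) hK.norm
      (fun n => Eventually.of_forall (hKεb _ (he n))) (Eventually.of_forall fun p => ?_)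
    by_cases hp : p.2 < p.1
    · have hp' : 0 < p.1 - p.2 := sub_pos.2 hp
      simp only [Kε, weylKernel, hp, if_true, div_eq_mul_inv]
      rw [← Real.rpow_neg hp'.le]
      exact (hshift _ hp' _).const_mul _
    · simp [Kε, weylKernel, hp]
  -- Integrating each half first in the variable absent from h, both contribute ε^(-β)/β times ∫ h.
  -- These cancel and only the boundary terms at t and at 0 survive; the latter will cancel the term
  -- h(s)/s^β of the Weyl derivative.
  have hcalc : ∀ ε, 0 < ε → β * ∫ p, Kε ε p ∂((volume.restrict (Ioo 0 t)).prod
      (volume.restrict (Ioo 0 t))) =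
      (∫ u in 0..t, (t - u + ε) ^ (-β) * h u) - ∫ s in 0..t, (s + ε) ^ (-β) * h s := by
    intro ε hε
    rw [integral_prod _ (hKεi ε hε)]
    have hcont : ∀ s, 0 < s → ContinuousOn (fun u => (s - u + ε) ^ (-(β + 1))) (uIcc 0 s) := by
      intro s hs u hu
      rw [uIcc_of_le hs.le] at hu
      exact (ContinuousAt.rpow_const (by fun_prop)
        (Or.inl (by linarith [hu.2]))).continuousWithinAt
    have hrow : ∀ s ∈ Ioo 0 t, ∫ u in Ioo 0 t, Kε ε (s, u) =
        h s * ((ε ^ (-β) - (s + ε) ^ (-β)) / β) - ∫ u in 0..s, (s - u + ε) ^ (-(β + 1)) * h u := by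
      intro s hs
      have e1 : ∫ u in Ioo 0 t, Kε ε (s, u) =
          ∫ u in 0..s, (h s - h u) * (s - u + ε) ^ (-(β + 1)) :=
        setIntegral_Ioo_ite_lt_right hs fun u => (h s - h u) * (s - u + ε) ^ (-(β + 1))
      have hIs : IntervalIntegrable h volume 0 s := hIt.mono_set (by
        rw [uIcc_of_le hs.1.le, uIcc_of_le ht0.le]; exact Icc_subset_Icc_right hs.2.le)
      rw [e1]
      have e2 : (fun u => (h s - h u) * (s - u + ε) ^ (-(β + 1))) = fun u =>
          h s * (s - u + ε) ^ (-(β + 1)) - (s - u + ε) ^ (-(β + 1)) * h u := by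
        ext u; ring
      rw [e2, intervalIntegral.integral_sub ((hcont s hs.1).intervalIntegrable.const_mul _)
        (hIs.continuousOn_mul (hcont s hs.1)), intervalIntegral.integral_const_mul,
        integral_shifted_rpow' h0 hε hs.1.le, sub_zero]
    have hv := volterra_swap (M := ε ^ (-β) / β) ht0.le hIt
      (K := fun s u => (s - u + ε) ^ (-(β + 1))) (by unfold Function.uncurry; fun_prop)
      (fun u hu => intervalIntegrable_shifted_rpow hε hu.2.le) (fun u hu => by
        calc _ = ∫ s in u..t, (s - u + ε) ^ (-(β + 1)) := by
              refine intervalIntegral.integral_congr fun s hs => abs_of_nonneg ?_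
              rw [uIcc_of_le hu.2.le] at hs
              exact Real.rpow_nonneg (by linarith [hs.1]) _
          _ ≤ _ := by
              rw [integral_shifted_rpow h0 hε hu.2.le]
              gcongr
              linarith [Real.rpow_nonneg (by linarith [hu.2] : 0 ≤ t - u + ε) (-β)])
    have hbd : ∀ f : ℝ → ℝ, Measurable f → (∀ s ∈ Ioo 0 t, ε ≤ f s) →
        IntervalIntegrable (fun s => (f s) ^ (-β) * h s) volume 0 t := by
      intro f hf hfε
      rw [intervalIntegrable_iff_integrableOn_Ioo_of_le ht0.le] at hIt ⊢
      refine Integrable.mono' (hIt.norm.const_mul (ε ^ (-β))) (by fun_prop) ?_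
      filter_upwards [ae_restrict_mem measurableSet_Ioo] with s hs
      rw [norm_mul, Real.norm_of_nonneg (Real.rpow_nonneg (hε.le.trans (hfε s hs)) _)]
      exact mul_le_mul_of_nonneg_right
        (Real.rpow_le_rpow_of_nonpos hε (hfε s hs) (by linarith)) (norm_nonneg _)
    have hb1 := hbd (fun s => s + ε) (by fun_prop) (fun s hs => by linarith [hs.1])
    have hb2 := hbd (fun s => t - s + ε) (by fun_prop) (fun s hs => by linarith [hs.2])
    rw [setIntegral_congr_fun measurableSet_Ioo hrow]
    rw [← intervalIntegral_eq_setIntegral_Ioo ht0.le]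
    have e3 : (fun s => h s * ((ε ^ (-β) - (s + ε) ^ (-β)) / β)) =
        fun s => (ε ^ (-β) / β) * h s - (1 / β) * ((s + ε) ^ (-β) * h s) := by
      ext s; ring
    rw [intervalIntegral.integral_sub (by
      rw [e3]; exact (hIt.const_mul _).sub (hb1.const_mul _)) hv.2.1, hv.2.2, e3,
      intervalIntegral.integral_sub (hIt.const_mul _) (hb1.const_mul _)]
    have e4 : ∫ u in 0..t, h u * ∫ s in u..t, (s - u + ε) ^ (-(β + 1)) =
        ∫ u in 0..t, ((ε ^ (-β) / β) * h u - (1 / β) * ((t - u + ε) ^ (-β) * h u)) := by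
      refine intervalIntegral.integral_congr fun u hu => ?_
      rw [uIcc_of_le ht0.le] at hu
      rw [integral_shifted_rpow h0 hε hu.2]
      ring
    rw [e4, intervalIntegral.integral_sub (hIt.const_mul _) (hb2.const_mul _)]
    simp only [intervalIntegral.integral_const_mul]
    field_simp
    ring
  have hconv2 : Tendsto (fun n => ∫ u in 0..t, (t - u + e n) ^ (-β) * h u) atTop
      (𝓝 (∫ u in 0..t, (t - u) ^ (-β) * h u)) := by
    rw [intervalIntegral_eq_setIntegral_Ioo ht0.le]
    simp only [intervalIntegral_eq_setIntegral_Ioo ht0.le]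
    refine tendsto_integral_of_dominated_convergence (fun u => ‖(t - u) ^ (-β) * h u‖)
      (fun n => by fun_prop)
      ((intervalIntegrable_iff_integrableOn_Ioo_of_le ht0.le).1 ht).norm (fun n => ?_) ?_
    · filter_upwards [ae_restrict_mem measurableSet_Ioo] with u hu
      have hpos : 0 < (t - u) := (sub_pos.2 hu.2)
      rw [norm_mul, norm_mul, Real.norm_of_nonneg (Real.rpow_nonneg hpos.le _),
        Real.norm_of_nonneg (Real.rpow_nonneg (by linarith [he n]) _)]
      refine mul_le_mul_of_nonneg_right ?_ (norm_nonneg _)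
      exact Real.rpow_le_rpow_of_nonpos hpos (by linarith [he n]) (by linarith)
    · filter_upwards [ae_restrict_mem measurableSet_Ioo] with u hu
      exact (hshift _ (sub_pos.2 hu.2) _).mul_const _
  have hconv3 : Tendsto (fun n => ∫ s in 0..t, (s + e n) ^ (-β) * h s) atTop
      (𝓝 (∫ s in 0..t, s ^ (-β) * h s)) := by
    rw [intervalIntegral_eq_setIntegral_Ioo ht0.le]
    simp only [intervalIntegral_eq_setIntegral_Ioo ht0.le]
    refine tendsto_integral_of_dominated_convergence (fun u => ‖u ^ (-β) * h u‖)
      (fun n => by fun_prop)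
      ((intervalIntegrable_iff_integrableOn_Ioo_of_le ht0.le).1 hIβt).norm (fun n => ?_) ?_
    · filter_upwards [ae_restrict_mem measurableSet_Ioo] with u hu
      have hpos : 0 < u := hu.1
      rw [norm_mul, norm_mul, Real.norm_of_nonneg (Real.rpow_nonneg hpos.le _),
        Real.norm_of_nonneg (Real.rpow_nonneg (by linarith [he n]) _)]
      refine mul_le_mul_of_nonneg_right ?_ (norm_nonneg _)
      exact Real.rpow_le_rpow_of_nonpos hpos (by linarith [he n]) (by linarith)
    · filter_upwards [ae_restrict_mem measurableSet_Ioo] with u hu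
      exact (hshift _ hu.1 _).mul_const _
  have hlimeq := tendsto_nhds_unique (hconv1.const_mul β)
    ((hconv2.sub hconv3).congr fun n => (hcalc _ (he n)).symm)
  have hA : Real.Gamma (1 - β) * ∫ s in 0..t, weylLeft β h s =
      (∫ s in 0..t, s ^ (-β) * h s) + β * ∫ p, weylKernel β h p
        ∂((volume.restrict (Ioo 0 t)).prod (volume.restrict (Ioo 0 t))) := by
    rw [integral_prod _ hK, intervalIntegral_eq_setIntegral_Ioo ht0.le,
      intervalIntegral_eq_setIntegral_Ioo ht0.le, ← integral_const_mul, ← integral_const_mul,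
      ← integral_add _ (hK.integral_prod_left.const_mul β)]
    · refine setIntegral_congr_fun measurableSet_Ioo fun s hs => ?_
      rw [integral_weylKernel hs, weylLeft, Real.rpow_neg hs.1.le, div_eq_inv_mul (h s)]
      field_simp
    · exact (intervalIntegrable_iff_integrableOn_Ioo_of_le ht0.le).1 hIβt
  rw [hA, hlimeq]; ring

/-- By Lebesgue differentiation both functions are almost everywhere the derivative of the same
primitive. -/
theorem ae_eq_of_integral_eq {T : ℝ} (hT : 0 ≤ T) {F G : ℝ → ℝ} (hF : IntervalIntegrable F volume 0 T)
    (hG : IntervalIntegrable G volume 0 T)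
    (h : ∀ x ∈ Ioo 0 T, ∫ t in 0..x, F t = ∫ t in 0..x, G t) :
    ∀ᵐ t, t ∈ Ioo 0 T → F t = G t := by
  filter_upwards [hF.ae_hasDerivAt_integral, hG.ae_hasDerivAt_integral] with t h1 h2 ht
  have htu : t ∈ uIcc 0 T := by rw [uIcc_of_le hT]; exact Ioo_subset_Icc_self ht
  have h0u : (0 : ℝ) ∈ uIcc 0 T := left_mem_uIcc
  refine (h1 htu 0 h0u).unique ((h2 htu 0 h0u).congr_of_eventuallyEq ?_)
  filter_upwards [isOpen_Ioo.mem_nhds ht] with x hx using h x hx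

/-- A function of `W₂^β` is the fractional integral of its left Weyl derivative. -/
theorem MemBesovTwo.fractionalIntegral_weylLeft {T β : ℝ} (h0 : 0 < β) (h1 : β < 1) (hT : 0 < T)
    {h : ℝ → ℝ} (hm : Measurable h) (hh : MemBesovTwo T β h) :
    ∀ᵐ t, t ∈ Ioo 0 T → ∫ s in 0..t, (t - s) ^ (β - 1) * weylLeft β h s = Real.Gamma β * h t := by
  have hA := hh.intervalIntegrable_weylLeft hT.le hm
  have hI := hh.intervalIntegrable hT.le h0.le hm
  have hΓ : 0 < Real.Gamma (1 - β) := Real.Gamma_pos_of_pos (by linarith)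
  have hsub : ∀ x ∈ Ioo 0 T, uIcc 0 x ⊆ uIcc 0 T := fun x hx => by
    rw [uIcc_of_le hx.1.le, uIcc_of_le hT.le]; exact Icc_subset_Icc_right hx.2.le
  have hv := fun x (hx : 0 ≤ x) (hAx : IntervalIntegrable (weylLeft β h) volume 0 x) =>
    volterra_swap_rpow (p := β - 1) (by linarith) hx hAx
    (ψ := fun _ => 1) measurable_const (C := 1) (by simp)
  simp only [one_mul] at hv
  -- It suffices to compare primitives. Up to the factor Γ(1-β), both sides reduce to the fractional
  -- integral of order β of the primitive of `weylLeft`: on the left because fractional integration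
  -- commutes with taking primitives, on the right by `MemBesovTwo.integral_weylLeft` and the beta
  -- integral.
  refine ae_eq_of_integral_eq hT.le (hv T hT.le hA).2.1 (hI.const_mul _) fun x hx => ?_
  have hAx := hA.mono_set (hsub x hx)
  have hIx := hI.mono_set (hsub x hx)
  have e1 : ∫ t in 0..x, (x - t) ^ (β - 1) * (Real.Gamma (1 - β) * ∫ s in 0..t, weylLeft β h s) =
      ∫ t in 0..x, (x - t) ^ (β - 1) * ∫ s in 0..t, (t - s) ^ (-β) * h s := by
    rw [intervalIntegral_eq_setIntegral_Ioo hx.1.le, intervalIntegral_eq_setIntegral_Ioo hx.1.le]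
    refine setIntegral_congr_ae measurableSet_Ioo ?_
    filter_upwards [hh.integral_weylLeft h0 h1 hT hm] with t ht htx
    rw [ht ⟨htx.1, htx.2.trans hx.2⟩]
  rw [integral_rpow_mul_integral_rpow_neg h0 h1 hx.1.le hIx] at e1
  have e2 : ∫ t in 0..x, (x - t) ^ (β - 1) * (Real.Gamma (1 - β) * ∫ s in 0..t, weylLeft β h s) =
      Real.Gamma (1 - β) * ∫ t in 0..x, ∫ s in 0..t, (x - t) ^ (β - 1) * weylLeft β h s := by
    rw [← intervalIntegral.integral_const_mul]
    congr 1; ext t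
    rw [intervalIntegral.integral_const_mul]; ring
  have e3 := (volterra_swap (M := x ^ β / β) hx.1.le hAx (K := fun t _ => (x - t) ^ (β - 1))
    (by unfold Function.uncurry; fun_prop)
    (fun s _ => intervalIntegrable_sub_rpow' (by linarith) _ _ _) (fun s hs => by
      calc _ = ∫ t in s..x, (x - t) ^ (β - 1) := by
            refine intervalIntegral.integral_congr fun t ht => abs_of_nonneg ?_
            rw [uIcc_of_le hs.2.le] at ht
            exact Real.rpow_nonneg (by linarith [ht.2]) _
        _ ≤ _ := by
            rw [integral_sub_rpow' (by linarith), sub_add_cancel]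
            gcongr
            · linarith [hs.2]
            · linarith [hs.1])).2.2
  rw [(hv x hx.1.le hAx).2.2, intervalIntegral.integral_const_mul]
  rw [e2, e3] at e1
  simp only [integral_sub_rpow' (show -1 < β - 1 by linarith),
    integral_sub_rpow (show -1 < β - 1 by linarith)] at e1 ⊢
  have : Real.Gamma (1 - β) ≠ 0 := hΓ.ne'
  apply mul_left_cancel₀ this
  rw [e1]; ring

/-- Fractional integration by parts against a bounded function. -/
theorem MemBesovTwo.integral_mul_eq {T β : ℝ} (h0 : 0 < β) (h1 : β < 1) (hT : 0 < T)
    {h : ℝ → ℝ} (hm : Measurable h) (hh : MemBesovTwo T β h) {ψ : ℝ → ℝ} (hψ : Measurable ψ)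
    {C : ℝ} (hC : ∀ t, |ψ t| ≤ C) :
    Real.Gamma β * ∫ t in 0..T, h t * ψ t =
      ∫ s in 0..T, weylLeft β h s * ∫ t in s..T, ψ t * (t - s) ^ (β - 1) := by
  rw [← (volterra_swap_rpow (p := β - 1) (by linarith) hT.le
    (hh.intervalIntegrable_weylLeft hT.le hm) hψ hC).2.2, ← intervalIntegral.integral_const_mul,
    intervalIntegral_eq_setIntegral_Ioo hT.le, intervalIntegral_eq_setIntegral_Ioo hT.le]
  refine setIntegral_congr_ae measurableSet_Ioo ?_
  filter_upwards [hh.fractionalIntegral_weylLeft h0 h1 hT hm] with t ht htx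
  simp_rw [mul_assoc, intervalIntegral.integral_const_mul]
  rw [ht htx]; ring

/-! ### Smooth integrators, Steklov averages and the forward integral. -/

/-- For a differentiable integrator with bounded derivative, the right Weyl derivative of order
`1 - β` is minus the fractional integral of order `β` of the derivative. -/
theorem weylRight_eq_of_hasDerivAt {T β s : ℝ} (h0 : 0 < β) (hs : s < T)
    {G ψ : ℝ → ℝ} (hG : ∀ u, HasDerivAt G (ψ u) u) (hψ : Measurable ψ) {C : ℝ}
    (hC : ∀ t, |ψ t| ≤ C) :
    weylRight (1 - β) T (fun r => G r - G T) s =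
      -(1 / Real.Gamma β * ∫ t in s..T, ψ t * (t - s) ^ (β - 1)) := by
  have hC0 : 0 ≤ C := (abs_nonneg _).trans (hC 0)
  have hlip : ∀ u v, |G u - G v| ≤ C * |u - v| := fun u v =>
    Convex.norm_image_sub_le_of_norm_hasDerivWithin_le (s := univ) (fun x _ => (hG x).hasDerivWithinAt)
      (fun x _ => hC x) convex_univ (mem_univ v) (mem_univ u)
  have hGm : Measurable G := (continuous_iff_continuousAt.2 fun u => (hG u).continuousAt).measurable
  have hi1 : IntervalIntegrable (fun t => ψ t * (t - s) ^ (β - 1)) volume s T := by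
    refine ((intervalIntegrable_sub_rpow (p := β - 1) (by linarith) s s T).norm.const_mul C).mono_fun
      (by fun_prop) (Eventually.of_forall fun t => ?_)
    simp only [norm_mul, norm_norm]
    exact mul_le_mul_of_nonneg_right ((hC t).trans (le_abs_self C)) (norm_nonneg _)
  have hi2 : IntervalIntegrable (fun u => (G s - G u) * (u - s) ^ (β - 2)) volume s T := by
    rw [intervalIntegrable_iff_integrableOn_Ioo_of_le hs.le]
    have := (intervalIntegrable_sub_rpow (p := β - 1) (by linarith) s s T).norm.const_mul C
    rw [intervalIntegrable_iff_integrableOn_Ioo_of_le hs.le] at this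
    refine Integrable.mono' this (by fun_prop) ?_
    filter_upwards [ae_restrict_mem measurableSet_Ioo] with u hu
    have hu' : 0 < u - s := sub_pos.2 hu.1
    rw [norm_mul, Real.norm_of_nonneg (Real.rpow_nonneg hu'.le _),
      Real.norm_of_nonneg (Real.rpow_nonneg hu'.le _), show β - 1 = 1 + (β - 2) by ring,
      Real.rpow_add hu', Real.rpow_one, ← mul_assoc]
    refine mul_le_mul_of_nonneg_right ?_ (Real.rpow_nonneg hu'.le _)
    have := hlip s u
    rwa [abs_sub_comm s u, abs_of_pos hu'] at this
  have hi1n : IntervalIntegrable (fun u => -(ψ u * (u - s) ^ (β - 1))) volume s T := hi1.neg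
  -- Integration by parts on [s,T]. The boundary term at s is 0 and is approached continuously,
  -- since G is Lipschitz and hence the function is O((u-s)^β).
  have hftc := intervalIntegral.integral_eq_sub_of_hasDerivAt_of_le (a := s) (b := T)
    (f := fun u => (G s - G u) * (u - s) ^ (β - 1))
    (f' := fun u => -(ψ u * (u - s) ^ (β - 1)) + (β - 1) * ((G s - G u) * (u - s) ^ (β - 2)))
    hs.le ?_ ?_ (hi1n.add (hi2.const_mul _))
  · rw [intervalIntegral.integral_add hi1n (hi2.const_mul _), intervalIntegral.integral_neg,
      intervalIntegral.integral_const_mul] at hftc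
    unfold weylRight
    rw [show 1 - (1 - β) = β by ring]
    have e : ∫ u in s..T, (G s - G T - (G u - G T)) / (u - s) ^ (1 - β + 1) =
        ∫ u in s..T, (G s - G u) * (u - s) ^ (β - 2) := by
      refine intervalIntegral.integral_congr fun u hu => ?_
      rw [uIcc_of_le hs.le] at hu
      rw [show β - 2 = -(1 - β + 1) by ring, Real.rpow_neg (sub_nonneg.2 hu.1), div_eq_mul_inv]
      ring
    rw [e, div_eq_mul_inv (G s - G T), ← Real.rpow_neg (sub_nonneg.2 hs.le), neg_sub]
    simp only [sub_self, zero_mul, sub_zero] at hftc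
    have : (1 - β) * ∫ u in s..T, (G s - G u) * (u - s) ^ (β - 2) =
      -((G s - G T) * (T - s) ^ (β - 1)) - ∫ t in s..T, ψ t * (t - s) ^ (β - 1) := by linarith
    rw [this]; ring
  · intro u hu
    rcases eq_or_lt_of_le hu.1 with rfl | hlt
    · have : Tendsto (fun u => C * |u - s| ^ β) (𝓝[Icc s T] s) (𝓝 0) := by
        have h : ContinuousAt (fun u => C * |u - s| ^ β) s :=
          continuousAt_const.mul (ContinuousAt.rpow_const (by fun_prop) (Or.inr h0.le))
        have := h.tendsto
        simp only [sub_self, abs_zero, Real.zero_rpow h0.ne', mul_zero] at this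
        exact this.mono_left nhdsWithin_le_nhds
      rw [ContinuousWithinAt]
      simp only [sub_self, zero_mul]
      refine squeeze_zero_norm' ?_ this
      filter_upwards [self_mem_nhdsWithin] with u hu
      rcases eq_or_lt_of_le hu.1 with rfl | hlt
      · simp [Real.zero_rpow h0.ne']
      · have hu' : 0 < u - s := sub_pos.2 hlt
        rw [norm_mul, Real.norm_of_nonneg (Real.rpow_nonneg hu'.le _), abs_of_pos hu']
        nth_rw 2 [show β = 1 + (β - 1) by ring]
        rw [Real.rpow_add hu', Real.rpow_one, ← mul_assoc]
        refine mul_le_mul_of_nonneg_right ?_ (Real.rpow_nonneg hu'.le _)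
        have := hlip s u
        rwa [abs_sub_comm s u, abs_of_pos hu'] at this
    · refine ContinuousAt.continuousWithinAt (ContinuousAt.mul ?_ ?_)
      · exact continuousAt_const.sub (hG u).continuousAt
      · exact ContinuousAt.rpow_const (by fun_prop) (Or.inl (sub_pos.2 hlt).ne')
  · intro u hu
    have hu' : 0 < u - s := sub_pos.2 hu.1
    have d1 := (hG u).const_sub (G s)
    have d2 := ((hasDerivAt_id u).sub_const s).rpow_const (p := β - 1) (Or.inl hu'.ne')
    have := d1.mul d2
    refine this.congr_deriv ?_
    simp only [id]
    rw [show β - 1 - 1 = β - 2 by ring]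
    ring

theorem continuous_of_abs_sub_le_rpow {γ C : ℝ} (hγ : 0 < γ) {g : ℝ → ℝ}
    (hg : ∀ s t, |g s - g t| ≤ C * |s - t| ^ γ) : Continuous g := by
  refine continuous_iff_continuousAt.2 fun t => ?_
  rw [ContinuousAt, tendsto_iff_norm_sub_tendsto_zero]
  have h : Tendsto (fun s => C * |s - t| ^ γ) (𝓝 t) (𝓝 0) := by
    have h : ContinuousAt (fun u => C * |u - t| ^ γ) t :=
      continuousAt_const.mul (ContinuousAt.rpow_const (by fun_prop) (Or.inr hγ.le))
    have := h.tendsto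
    simpa [Real.zero_rpow hγ.ne'] using this
  exact squeeze_zero (fun _ => norm_nonneg _) (fun s => hg s t) h

/-- Forward Steklov average. -/
noncomputable def steklov (δ : ℝ) (g : ℝ → ℝ) (s : ℝ) : ℝ := δ⁻¹ * ∫ r in 0..δ, g (s + r)

/-- This is what turns a forward integral against g into an integral against a differentiable
integrator. -/
theorem hasDerivAt_steklov {δ : ℝ} {g : ℝ → ℝ} (hg : Continuous g) (s : ℝ) :
    HasDerivAt (steklov δ g) ((g (s + δ) - g s) / δ) s := by
  have e : steklov δ g = fun s => δ⁻¹ * ((∫ r in 0..(s + δ), g r) - ∫ r in 0..s, g r) := by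
    ext s
    rw [steklov, intervalIntegral.integral_comp_add_left (fun r => g r), add_zero,
      intervalIntegral.integral_interval_sub_left (hg.intervalIntegrable _ _)
        (hg.intervalIntegrable _ _)]
  rw [e]
  have h1 : HasDerivAt (fun s => ∫ r in 0..(s + δ), g r) (g (s + δ)) s :=
    (intervalIntegral.integral_hasDerivAt_right (hg.intervalIntegrable _ _)
      (hg.stronglyMeasurableAtFilter _ _) hg.continuousAt).comp_add_const s δ
  have h2 : HasDerivAt (fun s => ∫ r in 0..s, g r) (g s) s :=
    intervalIntegral.integral_hasDerivAt_right (hg.intervalIntegrable _ _)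
      (hg.stronglyMeasurableAtFilter _ _) hg.continuousAt
  refine ((h1.sub h2).const_mul δ⁻¹).congr_deriv ?_
  rw [div_eq_inv_mul]

/-- An average of translates inherits the modulus of continuity with the same constant, uniformly in
δ; the domination argument for δ → 0 rests on this. -/
theorem abs_steklov_sub_le {δ C γ : ℝ} (hδ : 0 < δ) {g : ℝ → ℝ} (hc : Continuous g)
    (hg : ∀ s t, |g s - g t| ≤ C * |s - t| ^ γ) (s t : ℝ) :
    |steklov δ g s - steklov δ g t| ≤ C * |s - t| ^ γ := by
  rw [steklov, steklov, ← mul_sub, ← intervalIntegral.integral_sub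
    ((by fun_prop : Continuous fun r => g (s + r)).intervalIntegrable _ _)
    ((by fun_prop : Continuous fun r => g (t + r)).intervalIntegrable _ _), abs_mul, abs_of_pos (inv_pos.2 hδ)]
  have := intervalIntegral.norm_integral_le_of_norm_le_const (a := 0) (b := δ)
    (f := fun r => g (s + r) - g (t + r)) (C := C * |s - t| ^ γ) (fun r _ => by
      have := hg (s + r) (t + r)
      rwa [add_sub_add_right_eq_sub] at this)
  rw [sub_zero, abs_of_pos hδ, Real.norm_eq_abs] at this
  calc _ ≤ δ⁻¹ * (C * |s - t| ^ γ * δ) := by gcongr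
    _ = _ := by field_simp

theorem abs_steklov_sub_self_le {δ C γ : ℝ} (hC : 0 ≤ C) (hγ : 0 ≤ γ) (hδ : 0 < δ) {g : ℝ → ℝ}
    (hc : Continuous g) (hg : ∀ s t, |g s - g t| ≤ C * |s - t| ^ γ) (s : ℝ) :
    |steklov δ g s - g s| ≤ C * δ ^ γ := by
  have e : g s = δ⁻¹ * ∫ r in 0..δ, g s := by
    rw [intervalIntegral.integral_const, smul_eq_mul, sub_zero]; field_simp
  rw [e]
  rw [steklov, ← mul_sub, ← intervalIntegral.integral_sub
    ((by fun_prop : Continuous fun r => g (s + r)).intervalIntegrable _ _)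
    intervalIntegrable_const, abs_mul, abs_of_pos (inv_pos.2 hδ)]
  have := intervalIntegral.norm_integral_le_of_norm_le_const (a := 0) (b := δ)
    (f := fun r => g (s + r) - g s) (C := C * δ ^ γ) (fun r hr => by
      rw [uIoc_of_le hδ.le] at hr
      refine (hg (s + r) s).trans ?_
      rw [add_sub_cancel_left, abs_of_pos hr.1]
      exact mul_le_mul_of_nonneg_left (Real.rpow_le_rpow hr.1.le hr.2 hγ) hC)
  rw [sub_zero, abs_of_pos hδ, Real.norm_eq_abs] at this
  calc _ ≤ δ⁻¹ * (C * δ ^ γ * δ) := by gcongr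
    _ = _ := by field_simp

theorem weylRight_sub_eq {T β s : ℝ} (hs : s < T) (g : ℝ → ℝ) :
    weylRight (1 - β) T (fun r => g r - g T) s = 1 / Real.Gamma β *
      ((g s - g T) * (T - s) ^ (β - 1) + (1 - β) * ∫ u in s..T, (g s - g u) * (u - s) ^ (β - 2)) := by
  unfold weylRight
  rw [show 1 - (1 - β) = β by ring, div_eq_mul_inv (g s - g T),
    ← Real.rpow_neg (sub_nonneg.2 hs.le), neg_sub]
  congr 3
  refine intervalIntegral.integral_congr fun u hu => ?_
  rw [uIcc_of_le hs.le] at hu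
  rw [show β - 2 = -(1 - β + 1) by ring, Real.rpow_neg (sub_nonneg.2 hu.1), div_eq_mul_inv]
  ring

theorem abs_sub_mul_rpow_le {γ C : ℝ} {g : ℝ → ℝ} (hg : ∀ s t, |g s - g t| ≤ C * |s - t| ^ γ)
    {s u : ℝ} (hu : s < u) (p : ℝ) :
    |(g s - g u) * (u - s) ^ p| ≤ C * (u - s) ^ (γ + p) := by
  have hu' : 0 < u - s := sub_pos.2 hu
  rw [abs_mul, abs_of_nonneg (Real.rpow_nonneg hu'.le p), Real.rpow_add hu', ← mul_assoc]
  refine mul_le_mul_of_nonneg_right ?_ (Real.rpow_nonneg hu'.le p)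
  have := hg s u
  rwa [abs_sub_comm s u, abs_of_pos hu'] at this

/-- The integrand is O((u-s)^(γ+β-2)), integrable exactly because γ > 1 - β. The bound depends on g
only through its Hölder data, hence serves all Steklov averages at once. -/
theorem abs_weylRight_sub_le {T β γ C : ℝ} (h0 : 0 < β) (h1 : β < 1) (hγ : 1 - β < γ)
    (hC : 0 ≤ C) {g : ℝ → ℝ} (hg : ∀ s t, |g s - g t| ≤ C * |s - t| ^ γ) {s : ℝ}
    (hs : s ∈ Ioo 0 T) :
    |weylRight (1 - β) T (fun r => g r - g T) s| ≤ 1 / Real.Gamma β *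
      (C * T ^ (γ + (β - 1)) + (1 - β) * (C * (T ^ (γ + (β - 1)) / (γ + (β - 1))))) := by
  have hΓ := Real.Gamma_pos_of_pos h0
  have hp : 0 < γ + (β - 1) := by linarith
  have hTs : (T - s) ^ (γ + (β - 1)) ≤ T ^ (γ + (β - 1)) :=
    Real.rpow_le_rpow (by linarith [hs.2]) (by linarith [hs.1]) hp.le
  rw [weylRight_sub_eq hs.2, abs_mul, abs_of_pos (by positivity : 0 < 1 / Real.Gamma β)]
  refine mul_le_mul_of_nonneg_left ((abs_add_le _ _).trans (add_le_add ?_ ?_)) (by positivity)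
  · exact (abs_sub_mul_rpow_le hg hs.2 _).trans (by gcongr)
  · rw [abs_mul, abs_of_pos (by linarith : 0 < 1 - β)]
    refine mul_le_mul_of_nonneg_left ?_ (by linarith)
    have := intervalIntegral.norm_integral_le_of_norm_le (a := s) (b := T)
      (f := fun u => (g s - g u) * (u - s) ^ (β - 2)) (g := fun u => C * (u - s) ^ (γ + (β - 2)))
      hs.2.le (Eventually.of_forall fun u hu => abs_sub_mul_rpow_le hg hu.1 _)
      ((intervalIntegrable_sub_rpow (by linarith) _ _ _).const_mul C)
    refine this.trans ?_
    rw [intervalIntegral.integral_const_mul, integral_sub_rpow (by linarith),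
      show γ + (β - 2) + 1 = γ + (β - 1) by ring]
    gcongr

theorem aestronglyMeasurable_weylRight_sub {T β : ℝ} {g : ℝ → ℝ} (hg : Measurable g) :
    AEStronglyMeasurable (weylRight (1 - β) T (fun r => g r - g T)) (volume.restrict (Ioo 0 T)) := by
  have hm : Measurable (fun p : ℝ × ℝ => if p.1 < p.2 then
      (g p.1 - g p.2) * (p.2 - p.1) ^ (β - 2) else 0) :=
    Measurable.ite (measurableSet_lt measurable_fst measurable_snd) (by fun_prop) measurable_const
  have h2 : AEStronglyMeasurable (fun s => ∫ u in Ioo 0 T, if s < u then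
      (g s - g u) * (u - s) ^ (β - 2) else 0) (volume.restrict (Ioo 0 T)) :=
    (hm.stronglyMeasurable.integral_prod_right' (ν := volume.restrict (Ioo 0 T))).aestronglyMeasurable
  have h3 : AEStronglyMeasurable (fun s => (g s - g T) * (T - s) ^ (β - 1))
    (volume.restrict (Ioo 0 T)) := by fun_prop
  refine ((h3.add (h2.const_mul (1 - β))).const_mul (1 / Real.Gamma β)).congr ?_
  filter_upwards [ae_restrict_mem measurableSet_Ioo] with s hs
  rw [weylRight_sub_eq hs.2, ← setIntegral_Ioo_ite_lt_left hs]
  rfl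

theorem tendsto_weylRight_steklov {T β γ C : ℝ} (h1 : β < 1) (hγ : 1 - β < γ)
    (hC : 0 ≤ C) {g : ℝ → ℝ} (hg : ∀ s t, |g s - g t| ≤ C * |s - t| ^ γ) {δ : ℕ → ℝ}
    (hδ : ∀ n, 0 < δ n) (hlim : Tendsto δ atTop (𝓝 0)) {s : ℝ} (hs : s < T) :
    Tendsto (fun n => weylRight (1 - β) T (fun r => steklov (δ n) g r - steklov (δ n) g T) s)
      atTop (𝓝 (weylRight (1 - β) T (fun r => g r - g T) s)) := by
  have hc := continuous_of_abs_sub_le_rpow (by linarith) hg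
  have hpt : ∀ u, Tendsto (fun n => steklov (δ n) g u) atTop (𝓝 (g u)) := by
    intro u
    rw [tendsto_iff_norm_sub_tendsto_zero]
    have h : Tendsto (fun n => C * (δ n) ^ γ) atTop (𝓝 0) := by
      have := (hlim.rpow_const (p := γ) (Or.inr (by linarith))).const_mul C
      simpa [Real.zero_rpow (show γ ≠ 0 by linarith)] using this
    exact squeeze_zero (fun _ => norm_nonneg _)
      (fun n => abs_steklov_sub_self_le hC (by linarith) (hδ n) hc hg u) h
  have hcs : ∀ n, Continuous (steklov (δ n) g) := fun n =>
    continuous_iff_continuousAt.2 fun u => (hasDerivAt_steklov hc u).continuousAt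
  simp only [weylRight_sub_eq hs]
  refine Tendsto.const_mul _ (Tendsto.add (((hpt s).sub (hpt T)).mul_const _)
    (Tendsto.const_mul _ ?_))
  refine intervalIntegral.tendsto_integral_filter_of_dominated_convergence
    (fun u => C * (u - s) ^ (γ + (β - 2))) (Eventually.of_forall fun n => ?_)
    (Eventually.of_forall fun n => Eventually.of_forall fun u hu => ?_)
    ((intervalIntegrable_sub_rpow (by linarith) _ _ _).const_mul C)
    (Eventually.of_forall fun u _ => ((hpt s).sub (hpt u)).mul_const _)
  · have := (hcs n).measurable
    fun_prop
  · rw [uIoc_of_le hs.le] at hu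
    exact abs_sub_mul_rpow_le (abs_steklov_sub_le (hδ n) hc hg) hu.1 _

theorem MemBesovTwo.intervalIntegrable_glsIntegrand {T β γ C : ℝ} (h0 : 0 < β) (h1 : β < 1)
    (hT : 0 < T) (hγ : 1 - β < γ) (hC : 0 ≤ C) {h g : ℝ → ℝ} (hm : Measurable h)
    (hh : MemBesovTwo T β h) (hg : ∀ s t, |g s - g t| ≤ C * |s - t| ^ γ) :
    IntervalIntegrable (glsIntegrand T β h g) volume 0 T := by
  have hA := hh.intervalIntegrable_weylLeft hT.le hm
  have hc := continuous_of_abs_sub_le_rpow (by linarith) hg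
  rw [intervalIntegrable_iff_integrableOn_Ioo_of_le hT.le] at hA ⊢
  refine Integrable.mono' (hA.norm.mul_const (1 / Real.Gamma β *
      (C * T ^ (γ + (β - 1)) + (1 - β) * (C * (T ^ (γ + (β - 1)) / (γ + (β - 1)))))))
    (hA.1.mul (aestronglyMeasurable_weylRight_sub hc.measurable)) ?_
  filter_upwards [ae_restrict_mem measurableSet_Ioo] with s hs
  rw [glsIntegrand, norm_mul]
  refine mul_le_mul_of_nonneg_left ?_ (norm_nonneg _)
  exact abs_weylRight_sub_le h0 h1 hγ hC hg hs

/-- The generalized Lebesgue-Stieltjes integral is the limit of the forward integrals. -/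
theorem MemBesovTwo.tendsto_forwardIntegral {T β γ C : ℝ} (h0 : 0 < β) (h1 : β < 1)
    (hT : 0 < T) (hγ : 1 - β < γ) (hC : 0 ≤ C) {h g : ℝ → ℝ} (hm : Measurable h)
    (hh : MemBesovTwo T β h) (hg : ∀ s t, |g s - g t| ≤ C * |s - t| ^ γ)
    (hgb : ∃ B, ∀ s, |g s| ≤ B) {δ : ℕ → ℝ}
    (hδ : ∀ n, 0 < δ n) (hlim : Tendsto δ atTop (𝓝 0)) :
    Tendsto (fun n => ∫ s in 0..T, h s * ((g (s + δ n) - g s) / δ n)) atTop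
      (𝓝 (glsIntegral T β h g)) := by
  have hA := hh.intervalIntegrable_weylLeft hT.le hm
  rw [intervalIntegrable_iff_integrableOn_Ioo_of_le hT.le] at hA
  have hc := continuous_of_abs_sub_le_rpow (by linarith) hg
  have hcm := hc.measurable
  have hcs : ∀ n, Continuous (steklov (δ n) g) := fun n =>
    continuous_iff_continuousAt.2 fun u => (hasDerivAt_steklov hc u).continuousAt
  obtain ⟨B, hB⟩ := hgb
  have hΓ := (Real.Gamma_pos_of_pos h0).ne'
  -- The average has a bounded derivative, so its right Weyl derivative is minus a fractional
  -- integral; the two minus signs cancel and fractional integration by parts applies.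
  have key : ∀ n, glsIntegral T β h (steklov (δ n) g) =
      ∫ s in 0..T, h s * ((g (s + δ n) - g s) / δ n) := by
    intro n
    have hb : ∀ s, |(g (s + δ n) - g s) / δ n| ≤ (B + B) / δ n := fun s => by
      rw [abs_div, abs_of_pos (hδ n)]
      have := hδ n
      gcongr
      exact (abs_sub _ _).trans (add_le_add (hB _) (hB _))
    have hψ : Measurable fun s => (g (s + δ n) - g s) / δ n := by fun_prop
    have e := hh.integral_mul_eq h0 h1 hT hm hψ hb
    apply mul_left_cancel₀ hΓ
    rw [e, glsIntegral, ← intervalIntegral.integral_neg, ← intervalIntegral.integral_const_mul,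
      intervalIntegral_eq_setIntegral_Ioo hT.le, intervalIntegral_eq_setIntegral_Ioo hT.le]
    refine setIntegral_congr_fun measurableSet_Ioo fun s hs => ?_
    simp only [glsIntegrand]
    rw [weylRight_eq_of_hasDerivAt h0 hs.2 (fun u => hasDerivAt_steklov hc u) hψ hb]
    field_simp
  simp only [← key]
  unfold glsIntegral
  refine Tendsto.neg ?_
  simp only [intervalIntegral_eq_setIntegral_Ioo hT.le]
  refine tendsto_integral_of_dominated_convergence (fun s => ‖weylLeft β h s‖ * (1 / Real.Gamma β *
      (C * T ^ (γ + (β - 1)) + (1 - β) * (C * (T ^ (γ + (β - 1)) / (γ + (β - 1)))))))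
    (fun n => hA.1.mul (aestronglyMeasurable_weylRight_sub (hcs n).measurable))
    (hA.norm.mul_const _) (fun n => ?_) ?_
  · filter_upwards [ae_restrict_mem measurableSet_Ioo] with s hs
    rw [glsIntegrand, norm_mul]
    exact mul_le_mul_of_nonneg_left
      (abs_weylRight_sub_le h0 h1 hγ hC (abs_steklov_sub_le (hδ n) hc hg) hs) (norm_nonneg _)
  · filter_upwards [ae_restrict_mem measurableSet_Ioo] with s hs
    exact (tendsto_weylRight_steklov h1 hγ hC hg hδ hlim hs.2).const_mul _

/-! ### One-variable estimates: left derivatives and bounded variation. -/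

/-- Mean value inequality for a function with a left derivative. -/
theorem abs_sub_sub_mul_le_of_hasDerivWithinAt_Iic {F F' : ℝ → ℝ} (hF : Continuous F)
    (hF' : ∀ v, HasDerivWithinAt F (F' v) (Iic v) v) {a b c M : ℝ}
    (hM : ∀ v ∈ uIcc a b, |F' v - c| ≤ M) : |F b - F a - c * (b - a)| ≤ M * |b - a| := by
  wlog hab : a ≤ b generalizing a b
  · have := this (a := b) (b := a) (by rwa [uIcc_comm]) (le_of_not_ge hab)
    rw [abs_sub_comm b a, ← abs_neg]
    convert this using 2
    ring
  rw [uIcc_of_le hab] at hM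
  -- Reflection turns the left derivative into a right derivative, to which the mean value
  -- inequality for right derivatives applies.
  let ψ : ℝ → ℝ := fun v => F (-v) - c * (-v)
  have h := norm_image_sub_le_of_norm_deriv_right_le_segment (f := ψ) (a := -b) (b := -a)
    (f' := fun v => -(F' (-v) - c)) (C := M) (by fun_prop) (fun v hv => ?_) (fun v hv => ?_)
    (-a) ⟨by linarith, le_rfl⟩
  · simp only [ψ, neg_neg, Real.norm_eq_abs] at h
    rw [abs_of_nonneg (sub_nonneg.2 hab), ← abs_neg]
    convert h using 2 <;> ring
  · have h1 : HasDerivWithinAt (fun w : ℝ => -w) (-1) (Ici v) v := (hasDerivAt_neg v).hasDerivWithinAt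
    have h2 := HasDerivWithinAt.scomp v (hF' (-v)) h1 (fun w hw => by simpa using hw)
    have h3 := h2.sub (h1.const_mul c)
    refine h3.congr_deriv ?_
    simp; ring
  · rw [norm_neg]
    exact hM _ ⟨by linarith [hv.2], by linarith [hv.1]⟩

/-- The increments of a function of bounded variation over windows of half-width `η` are
dominated by a function of integral at most `2 η` times the variation. -/
theorem exists_window_bound {φ : ℝ → ℝ} {R η : ℝ} (hR : 0 ≤ R) (hη : 0 ≤ η) {C : ℝ≥0}
    (hφ : eVariationOn φ (Icc (-R) R) ≤ C) :
    ∃ D : ℝ → ℝ, Measurable D ∧ (∀ y, 0 ≤ D y) ∧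
      ∫⁻ y in Icc (-R) R, ENNReal.ofReal (D y) ≤ ENNReal.ofReal (2 * η * C) ∧
      ∀ y ∈ Icc (-R) R, ∀ z ∈ Icc (-R) R, |y - z| ≤ η → |φ y - φ z| ≤ D y := by
  have hfin : ∀ y, eVariationOn φ (Icc (-R) R ∩ Iic y) ≤ C := fun y =>
    (eVariationOn.mono φ inter_subset_left).trans hφ
  have hne : ∀ y, eVariationOn φ (Icc (-R) R ∩ Iic y) ≠ ∞ := fun y =>
    ((hfin y).trans_lt ENNReal.coe_lt_top).ne
  -- Variation up to y: monotone on the whole line, with values in [0, C], so that windows may stick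
  -- out of [-R, R].
  let U : ℝ → ℝ := fun y => (eVariationOn φ (Icc (-R) R ∩ Iic y)).toReal
  have hU : Monotone U := fun a b hab => ENNReal.toReal_mono (hne b)
    (eVariationOn.mono φ (inter_subset_inter_right _ (Iic_subset_Iic.2 hab)))
  have hU0 : ∀ y, 0 ≤ U y := fun y => ENNReal.toReal_nonneg
  have hUC : ∀ y, U y ≤ C := fun y => ENNReal.toReal_mono ENNReal.coe_ne_top (hfin y)
  have hinc : ∀ a ∈ Icc (-R) R, ∀ b ∈ Icc (-R) R, a ≤ b → |φ a - φ b| ≤ U b - U a := by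
    intro a ha b hb hab
    have h1 := eVariationOn.add_le_union φ (s := Icc (-R) R ∩ Iic a) (t := Icc a b) (by
      rintro x ⟨_, hx⟩ y ⟨hy, _⟩; exact le_trans hx hy)
    have h2 : eVariationOn φ (Icc (-R) R ∩ Iic a ∪ Icc a b) ≤
        eVariationOn φ (Icc (-R) R ∩ Iic b) := by
      refine eVariationOn.mono φ ?_
      rintro x (⟨hx, hxa⟩ | ⟨hx1, hx2⟩)
      · exact ⟨hx, le_trans hxa hab⟩
      · exact ⟨⟨ha.1.trans hx1, hx2.trans hb.2⟩, hx2⟩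
    have h3 := eVariationOn.edist_le φ (left_mem_Icc.2 hab) (right_mem_Icc.2 hab)
    have h4 : eVariationOn φ (Icc (-R) R ∩ Iic a) + edist (φ a) (φ b) ≤
        eVariationOn φ (Icc (-R) R ∩ Iic b) := (add_le_add le_rfl h3).trans (h1.trans h2)
    have h5 := ENNReal.toReal_mono (hne b) h4
    rw [ENNReal.toReal_add (hne a) (edist_ne_top _ _), edist_dist, ENNReal.toReal_ofReal dist_nonneg,
      Real.dist_eq] at h5
    simp only [U]; linarith
  -- The integral of this difference reduces to the integrals of `U` over two strips of length 2η
  -- around R and -R; the first is at most 2ηC and the second, which is subtracted, is nonnegative.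
  refine ⟨fun y => U (y + η) - U (y - η), ?_, fun y => sub_nonneg.2 (hU (by linarith)), ?_, ?_⟩
  · have := hU.measurable
    fun_prop
  · have hi : ∀ a b, IntervalIntegrable U volume a b := fun a b => hU.intervalIntegrable
    have hi1 : IntervalIntegrable (fun y => U (y + η)) volume (-R) R :=
      (hU.comp (monotone_id.add_const η)).intervalIntegrable
    have hi2 : IntervalIntegrable (fun y => U (y - η)) volume (-R) R :=
      Monotone.intervalIntegrable fun a b hab => hU (by linarith)
    have hRR : -R ≤ R := by linarith
    rw [← ofReal_integral_eq_lintegral_ofReal]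
    · refine ENNReal.ofReal_le_ofReal ?_
      rw [integral_Icc_eq_integral_Ioc, ← intervalIntegral.integral_of_le hRR,
        intervalIntegral.integral_sub hi1 hi2, intervalIntegral.integral_comp_add_right,
        intervalIntegral.integral_comp_sub_right]
      have e1 := intervalIntegral.integral_add_adjacent_intervals (hi (-R - η) (-R + η)) (hi (-R + η) (R + η))
      have e2 := intervalIntegral.integral_add_adjacent_intervals (hi (-R - η) (R - η)) (hi (R - η) (R + η))
      have b1 : 0 ≤ ∫ x in (-R - η)..(-R + η), U x :=
        intervalIntegral.integral_nonneg (by linarith) fun x _ => hU0 x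
      have b2 : ∫ x in (R - η)..(R + η), U x ≤ ∫ x in (R - η)..(R + η), (C : ℝ) :=
        intervalIntegral.integral_mono_on (by linarith) (hi _ _) intervalIntegrable_const
          fun x _ => hUC x
      rw [intervalIntegral.integral_const, smul_eq_mul] at b2
      linarith
    · rw [← IntegrableOn, integrableOn_Icc_iff_integrableOn_Ioc, ← intervalIntegrable_iff_integrableOn_Ioc_of_le hRR]
      exact hi1.sub hi2
    · exact Eventually.of_forall fun y => sub_nonneg.2 (hU (by linarith))
  · intro y hy z hz hyz
    rw [abs_le] at hyz
    rcases le_total y z with h | h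
    · refine (hinc y hy z hz h).trans (sub_le_sub (hU (by linarith)) (hU (by linarith)))
    · rw [abs_sub_comm]
      refine (hinc z hz y hy h).trans (sub_le_sub (hU (by linarith)) (hU (by linarith)))

/-! ### Interpolating between two points one coordinate at a time. -/

section MixedPoints

variable {n : ℕ}

/-- The point with the first `j` coordinates of `y` and the others of `x`. -/
def mixedPoint (j : ℕ) (x y : Fin n → ℝ) : Fin n → ℝ := fun i => if (i : ℕ) < j then y i else x i

theorem mixedPoint_zero (x y : Fin n → ℝ) : mixedPoint 0 x y = x := by
  ext i; simp [mixedPoint]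

theorem mixedPoint_self (x y : Fin n → ℝ) : mixedPoint n x y = y := by
  ext i; simp [mixedPoint]

theorem update_mixedPoint_self (j : Fin n) (x y : Fin n → ℝ) :
    Function.update (mixedPoint j x y) j (x j) = mixedPoint j x y := by
  ext i; rcases eq_or_ne i j with rfl | h <;> simp [mixedPoint, *]

theorem update_mixedPoint_succ (j : Fin n) (x y : Fin n → ℝ) :
    Function.update (mixedPoint j x y) j (y j) = mixedPoint (j + 1) x y := by
  ext i
  rcases eq_or_ne i j with rfl | h
  · simp [mixedPoint]
  · have : (i : ℕ) ≠ j := fun e => h (Fin.ext e)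
    simp only [mixedPoint, Function.update_of_ne h]
    congr 1
    simp only [eq_iff_iff]; omega

theorem sum_mixedPoint_sub (F : (Fin n → ℝ) → ℝ) (x y : Fin n → ℝ) :
    ∑ j : Fin n, (F (mixedPoint (j + 1) x y) - F (mixedPoint j x y)) = F y - F x := by
  rw [Fin.sum_univ_eq_sum_range (fun j => F (mixedPoint (j + 1) x y) - F (mixedPoint j x y)),
    Finset.sum_range_sub (fun j => F (mixedPoint j x y)), mixedPoint_zero, mixedPoint_self]

theorem abs_mixedPoint_sub_le (F : (Fin n → ℝ) → ℝ) (x y : Fin n → ℝ) (k : Fin n) :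
    |F (mixedPoint k x y) - F x| ≤
      ∑ j : Fin n, |F (mixedPoint (j + 1) x y) - F (mixedPoint j x y)| := by
  have h1 : F (mixedPoint k x y) - F x =
      ∑ j ∈ Finset.range k, (F (mixedPoint (j + 1) x y) - F (mixedPoint j x y)) := by
    rw [Finset.sum_range_sub (fun j => F (mixedPoint j x y)), mixedPoint_zero]
  rw [h1, Fin.sum_univ_eq_sum_range (fun j => |F (mixedPoint (j + 1) x y) - F (mixedPoint j x y)|)]
  exact (Finset.abs_sum_le_sum_abs _ _).trans (Finset.sum_le_sum_of_subset_of_nonneg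
    (Finset.range_mono k.2.le) fun _ _ _ => abs_nonneg _)

theorem mixedPoint_mem_Icc {j : ℕ} {R : ℝ} {x y : Fin n → ℝ} (hx : ∀ i, x i ∈ Icc (-R) R)
    (hy : ∀ i, y i ∈ Icc (-R) R) (i : Fin n) : mixedPoint j x y i ∈ Icc (-R) R := by
  unfold mixedPoint; split_ifs; exacts [hy i, hx i]

/-- The path from 0 to x through mixed points stays in the cube, and each of its n moves costs at
most the variation bound C. -/
theorem LocallyBVInEachVariable.exists_bound {h : (Fin n → ℝ) → ℝ}
    (hh : LocallyBVInEachVariable h) {R : ℝ} (hR : 0 ≤ R) :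
    ∃ B : ℝ, ∀ x : Fin n → ℝ, (∀ i, x i ∈ Icc (-R) R) → |h x| ≤ B := by
  obtain ⟨C, hC⟩ := hh R
  refine ⟨|h 0| + ∑ _j : Fin n, (C : ℝ), fun x hx => ?_⟩
  have h0 : ∀ i : Fin n, (0 : Fin n → ℝ) i ∈ Icc (-R) R := fun i => ⟨by simpa, by simpa⟩
  have h1 : |h x - h 0| ≤ ∑ _j : Fin n, (C : ℝ) := by
    rw [← sum_mixedPoint_sub h 0 x]
    refine (Finset.abs_sum_le_sum_abs _ _).trans (Finset.sum_le_sum fun j _ => ?_)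
    have h2 := (eVariationOn.edist_le (fun u => h (Function.update (mixedPoint j 0 x) j u))
      (hx j) (h0 j)).trans (hC j (mixedPoint j 0 x) (mixedPoint_mem_Icc h0 hx))
    rw [update_mixedPoint_succ, update_mixedPoint_self, edist_dist, Real.dist_eq] at h2
    have := ENNReal.toReal_mono ENNReal.coe_ne_top h2
    rwa [ENNReal.toReal_ofReal (abs_nonneg _)] at this
  have := abs_sub_abs_le_abs_sub (h x) (h 0)
  linarith

end MixedPoints

/-! ### Joint continuity of f and measurability of its left partial derivatives. -/

section LeftPartials

variable {n : ℕ} {f : (Fin n → ℝ) → ℝ} {df : Fin n → (Fin n → ℝ) → ℝ}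

theorem HasLeftPartialDeriv.hasDerivWithinAt_update (hdf : ∀ k x, HasLeftPartialDeriv f k x (df k x))
    (k : Fin n) (x : Fin n → ℝ) (v : ℝ) :
    HasDerivWithinAt (fun u => f (Function.update x k u)) (df k (Function.update x k v)) (Iic v) v := by
  have := hdf k (Function.update x k v)
  simpa [HasLeftPartialDeriv] using this

/-- The partial derivatives are locally bounded, so by the mean value inequality f is Lipschitz
along coordinate segments with locally uniform constants; summing over the mixed points gives joint
continuity. -/
theorem continuous_of_hasLeftPartialDeriv
    (hf : ∀ (k : Fin n) (x : Fin n → ℝ), Continuous fun u => f (Function.update x k u))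
    (hdf : ∀ k x, HasLeftPartialDeriv f k x (df k x)) (hbv : ∀ k, LocallyBVInEachVariable (df k)) :
    Continuous f := by
  refine continuous_iff_continuousAt.2 fun x => ?_
  let R := ‖x‖ + 1
  have hR : 0 ≤ R := by positivity
  choose B hB using fun k => (hbv k).exists_bound hR
  have hxR : ∀ i, x i ∈ Icc (-R) R := fun i => by
    have := norm_le_pi_norm x i
    rw [Real.norm_eq_abs, abs_le] at this
    constructor <;> simp only [R] <;> linarith [this.1, this.2]
  have hlim : Tendsto (fun y : Fin n → ℝ => ∑ k, B k * |y k - x k|) (𝓝 x) (𝓝 0) := by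
    have : Continuous fun y : Fin n → ℝ => ∑ k, B k * |y k - x k| := by fun_prop
    simpa using this.tendsto x
  rw [ContinuousAt, tendsto_iff_norm_sub_tendsto_zero]
  refine squeeze_zero' (Eventually.of_forall fun _ => norm_nonneg _) ?_ hlim
  filter_upwards [Metric.ball_mem_nhds x one_pos] with y hy
  have hyR : ∀ i, y i ∈ Icc (-R) R := fun i => by
    have h1 := norm_le_pi_norm y i
    have h2 : ‖y‖ ≤ ‖x‖ + 1 := by
      have := norm_le_norm_add_norm_sub' y x
      rw [mem_ball_iff_norm] at hy
      linarith
    rw [Real.norm_eq_abs, abs_le] at h1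
    constructor <;> simp only [R] <;> linarith [h1.1, h1.2]
  rw [← sum_mixedPoint_sub f x y]
  refine (norm_sum_le _ _).trans (Finset.sum_le_sum fun k _ => ?_)
  have := abs_sub_sub_mul_le_of_hasDerivWithinAt_Iic (hf k (mixedPoint k x y))
    (HasLeftPartialDeriv.hasDerivWithinAt_update hdf k (mixedPoint k x y)) (a := x k) (b := y k)
    (c := 0) (M := B k) fun v hv => by
      rw [sub_zero]
      refine hB k _ fun i => ?_
      rcases eq_or_ne i k with rfl | hik
      · rw [Function.update_self]
        exact uIcc_subset_Icc (hxR i) (hyR i) hv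
      · rw [Function.update_of_ne hik]; exact mixedPoint_mem_Icc hxR hyR i
  rwa [update_mixedPoint_succ, update_mixedPoint_self, zero_mul, sub_zero] at this

/-- A pointwise limit of continuous difference quotients, along steps 1/(m+1). -/
theorem measurable_of_hasLeftPartialDeriv (hf : Continuous f) {k : Fin n} {d : (Fin n → ℝ) → ℝ}
    (hdf : ∀ x, HasLeftPartialDeriv f k x (d x)) : Measurable d := by
  let e : ℕ → ℝ := fun m => 1 / ((m : ℝ) + 1)
  have he : ∀ m, 0 < e m := fun m => Nat.one_div_pos_of_nat
  have hlim : Tendsto e atTop (𝓝 0) := tendsto_one_div_add_atTop_nhds_zero_nat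
  refine measurable_of_tendsto_metrizable (f := fun m x =>
    (-e m)⁻¹ * (f (Function.update x k (x k - e m)) - f x)) (fun m => ?_) ?_
  · have : Continuous fun x : Fin n → ℝ => Function.update x k (x k - e m) :=
      continuous_id.update k (by fun_prop)
    have := hf.comp this
    exact ((this.sub hf).measurable).const_mul _
  · rw [tendsto_pi_nhds]
    intro x
    have h := hdf x
    rw [HasLeftPartialDeriv, hasDerivWithinAt_iff_tendsto_slope] at h
    have ht : Tendsto (fun m => x k - e m) atTop (𝓝[Iic (x k) \ {x k}] (x k)) := by
      refine tendsto_nhdsWithin_iff.2 ⟨by simpa using hlim.const_sub (x k), ?_⟩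
      refine Eventually.of_forall fun m => ⟨?_, ?_⟩
      · simp [(he m).le]
      · simp [(he m).ne']
    refine (h.comp ht).congr fun m => ?_
    simp [slope, Function.comp]

end LeftPartials

/-! ### Mean increments from independence and bounded densities. -/

/-- Independence lets w be frozen. The majorant D ignores z, so only the density of Y enters and
nothing need be known about the joint law of Y and Z. -/
theorem lintegral_le_of_indepFun_of_pdf_le {Ω E : Type*} [MeasurableSpace Ω] [MeasurableSpace E]
    {P : Measure Ω} [IsProbabilityMeasure P] {W : Ω → E} {Y Z : Ω → ℝ} (hW : Measurable W)
    (hY : Measurable Y) (hZ : Measurable Z) (hind : IndepFun W (fun ω => (Y ω, Z ω)) P)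
    (hpdf : HasPDF Y P volume) {c : ℝ≥0∞}
    (hc : ∀ᵐ y ∂(volume : Measure ℝ), pdf Y P volume y ≤ c)
    {Φ : E × ℝ × ℝ → ℝ≥0∞} (hΦ : Measurable Φ) {K : ℝ≥0∞}
    (hD : ∀ w, ∃ D : ℝ → ℝ≥0∞, Measurable D ∧ ∫⁻ y, D y ≤ K ∧ ∀ y z, Φ (w, y, z) ≤ D y) :
    ∫⁻ ω, Φ (W ω, Y ω, Z ω) ∂P ≤ c * K := by
  have hYZ : Measurable fun ω => (Y ω, Z ω) := hY.prodMk hZ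
  have : IsProbabilityMeasure (P.map W) := Measure.isProbabilityMeasure_map hW.aemeasurable
  have : IsProbabilityMeasure (P.map fun ω => (Y ω, Z ω)) :=
    Measure.isProbabilityMeasure_map hYZ.aemeasurable
  rw [← lintegral_map (f := Φ) hΦ (hW.prodMk hYZ),
    (indepFun_iff_map_prod_eq_prod_map_map hW.aemeasurable hYZ.aemeasurable).1 hind,
    lintegral_prod _ hΦ.aemeasurable]
  have hin : ∀ w, ∫⁻ p, Φ (w, p) ∂(P.map fun ω => (Y ω, Z ω)) ≤ c * K := by
    intro w
    obtain ⟨D, hDm, hDK, hDb⟩ := hD w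
    calc ∫⁻ p, Φ (w, p) ∂(P.map fun ω => (Y ω, Z ω))
        ≤ ∫⁻ p, D p.1 ∂(P.map fun ω => (Y ω, Z ω)) := lintegral_mono fun p => hDb p.1 p.2
      _ = ∫⁻ ω, D (Y ω) ∂P := lintegral_map (hDm.comp measurable_fst) hYZ
      _ = ∫⁻ y, pdf Y P volume y * D y := (pdf.lintegral_pdf_mul hDm.aemeasurable).symm
      _ ≤ ∫⁻ y, c * D y := lintegral_mono_ae (by filter_upwards [hc] with y hy; gcongr)
      _ = c * ∫⁻ y, D y := lintegral_const_mul _ hDm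
      _ ≤ c * K := by gcongr
  refine (lintegral_mono hin).trans ?_
  simp

section Windows

variable {n : ℕ}

/-- Pairs of points of the cube `[-N, N]^n` at sup-distance at most `η`. -/
def windowSet (n : ℕ) (N η : ℝ) : Set ((Fin n → ℝ) × (Fin n → ℝ)) :=
  {p | ∀ i, p.1 i ∈ Icc (-N) N ∧ p.2 i ∈ Icc (-N) N ∧ |p.1 i - p.2 i| ≤ η}

theorem measurable_indicator_windowSet {E : Type*} [MeasurableSpace E] {x y : E → Fin n → ℝ}
    {η : E → ℝ} (hx : Measurable x) (hy : Measurable y) (hη : Measurable η) (N : ℝ)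
    {F : (Fin n → ℝ) × (Fin n → ℝ) → ℝ≥0∞} (hF : Measurable F) :
    Measurable fun e => (windowSet n N (η e)).indicator F (x e, y e) := by
  have hS : MeasurableSet {e | (x e, y e) ∈ windowSet n N (η e)} := by
    have : {e | (x e, y e) ∈ windowSet n N (η e)} = ⋂ i, ({e | x e i ∈ Icc (-N) N} ∩
        ({e | y e i ∈ Icc (-N) N} ∩ {e | |x e i - y e i| ≤ η e})) := by
      ext e; simp [windowSet]
    rw [this]
    refine MeasurableSet.iInter fun i => MeasurableSet.inter ?_ (MeasurableSet.inter ?_ ?_)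
    · exact (by fun_prop : Measurable fun e => x e i) measurableSet_Icc
    · exact (by fun_prop : Measurable fun e => y e i) measurableSet_Icc
    · exact measurableSet_le (by fun_prop) hη
  exact (hF.comp (hx.prodMk hy)).indicator hS

theorem measurable_mixedPoint {E : Type*} [MeasurableSpace E] (j : ℕ) {x y : E → Fin n → ℝ}
    (hx : Measurable x) (hy : Measurable y) : Measurable fun e => mixedPoint j (x e) (y e) := by
  refine measurable_pi_lambda _ fun i => ?_
  unfold mixedPoint
  split_ifs
  · exact (measurable_pi_apply i).comp hy
  · exact (measurable_pi_apply i).comp hx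

theorem measurable_update_mixedPoint (j : Fin n) :
    Measurable fun p : (Fin n → ℝ) × (Fin n → ℝ) =>
      Function.update (mixedPoint j p.1 p.2) j 0 := by
  refine measurable_pi_lambda _ fun i => ?_
  rcases eq_or_ne i j with rfl | h
  · simp
  · simp only [Function.update_of_ne h]
    exact (measurable_pi_apply i).comp (measurable_mixedPoint _ measurable_fst measurable_snd)

variable {Ω : Type*} [MeasurableSpace Ω] {P : Measure Ω} {T : ℝ} {X : Fin n → ℝ → Ω → ℝ}

/-- Once coordinate j is overwritten by 0, the mixed point depends only on the processes with index
other than j. It involves both times s and r, so independence of whole processes is what is used. -/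
theorem indepFun_update_mixedPoint [IsProbabilityMeasure P]
    (hX : ∀ k, ∀ t ∈ Icc 0 T, Measurable (X k t))
    (hind : iIndepFun (fun k ω (t : Icc (0 : ℝ) T) => X k t ω) P) {s r : ℝ} (hs : s ∈ Icc 0 T)
    (hr : r ∈ Icc 0 T) (j : Fin n) :
    IndepFun (fun ω => Function.update (mixedPoint j (fun i => X i s ω) (fun i => X i r ω)) j 0)
      (fun ω => (X j s ω, X j r ω)) P := by
  have h := hind.indepFun_finset {j}ᶜ {j} disjoint_compl_left
    (fun k => measurable_pi_lambda _ fun t => hX k t t.2)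
  have := h.comp
    (φ := fun (w : ({j}ᶜ : Finset (Fin n)) → Icc (0 : ℝ) T → ℝ) (i : Fin n) =>
      if hi : i ∈ ({j}ᶜ : Finset (Fin n)) then
        (if (i : ℕ) < j then w ⟨i, hi⟩ ⟨r, hr⟩ else w ⟨i, hi⟩ ⟨s, hs⟩) else 0)
    (ψ := fun (w : ({j} : Finset (Fin n)) → Icc (0 : ℝ) T → ℝ) =>
      (w ⟨j, Finset.mem_singleton_self j⟩ ⟨s, hs⟩, w ⟨j, Finset.mem_singleton_self j⟩ ⟨r, hr⟩))
    (by
      refine measurable_pi_lambda _ fun i => ?_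
      split_ifs
      · fun_prop
      · fun_prop
      · fun_prop) (by fun_prop)
  convert this using 1
  · ext ω i
    rcases eq_or_ne i j with rfl | hij
    · simp
    · simp [hij, mixedPoint]
  · rfl

theorem lintegral_indicator_windowSet_le [IsProbabilityMeasure P]
    (hX : ∀ k, ∀ t ∈ Icc 0 T, Measurable (X k t))
    (hind : iIndepFun (fun k ω (t : Icc (0 : ℝ) T) => X k t ω) P) {s r : ℝ} (hs : s ∈ Icc 0 T)
    (hr : r ∈ Icc 0 T) {j : Fin n} (hpdf : HasPDF (X j s) P volume) {c : ℝ≥0∞}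
    (hc : ∀ᵐ y ∂(volume : Measure ℝ), pdf (X j s) P volume y ≤ c) {N η : ℝ} (hN : 0 ≤ N)
    {Ψ : (Fin n → ℝ) × ℝ × ℝ → ℝ≥0∞} (hΨ : Measurable Ψ) {K : ℝ≥0∞}
    (hD : ∀ w : Fin n → ℝ, (∀ i, w i ∈ Icc (-N) N) → ∃ D : ℝ → ℝ≥0∞, Measurable D ∧
      ∫⁻ y in Icc (-N) N, D y ≤ K ∧
      ∀ y ∈ Icc (-N) N, ∀ z ∈ Icc (-N) N, |y - z| ≤ η → Ψ (w, y, z) ≤ D y) :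
    ∫⁻ ω, (windowSet n N η).indicator
      (fun p => Ψ (Function.update (mixedPoint j p.1 p.2) j 0, p.1 j, p.2 j))
      (fun i => X i s ω, fun i => X i r ω) ∂P ≤ c * K := by
  let S : Set ((Fin n → ℝ) × ℝ × ℝ) :=
    {q | (∀ i, q.1 i ∈ Icc (-N) N) ∧ q.2.1 ∈ Icc (-N) N ∧ q.2.2 ∈ Icc (-N) N ∧ |q.2.1 - q.2.2| ≤ η}
  have hS : MeasurableSet S := by
    have : S = (⋂ i, {q | q.1 i ∈ Icc (-N) N}) ∩ ({q | q.2.1 ∈ Icc (-N) N} ∩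
        ({q | q.2.2 ∈ Icc (-N) N} ∩ {q | |q.2.1 - q.2.2| ≤ η})) := by
      ext q; simp [S]
    rw [this]
    refine MeasurableSet.inter (MeasurableSet.iInter fun i => ?_)
      (MeasurableSet.inter ?_ (MeasurableSet.inter ?_ ?_))
    · exact (by fun_prop : Measurable fun q : (Fin n → ℝ) × ℝ × ℝ => q.1 i) measurableSet_Icc
    · exact (by fun_prop : Measurable fun q : (Fin n → ℝ) × ℝ × ℝ => q.2.1) measurableSet_Icc
    · exact (by fun_prop : Measurable fun q : (Fin n → ℝ) × ℝ × ℝ => q.2.2) measurableSet_Icc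
    · exact measurableSet_le (by fun_prop) measurable_const
  have hXs : ∀ t ∈ Icc 0 T, Measurable fun ω => (fun i => X i t ω) := fun t ht =>
    measurable_pi_lambda _ fun i => hX i t ht
  have hW : Measurable fun ω =>
      Function.update (mixedPoint j (fun i => X i s ω) (fun i => X i r ω)) j 0 :=
    (measurable_update_mixedPoint j).comp ((hXs s hs).prodMk (hXs r hr))
  refine le_trans (lintegral_mono fun ω => ?_) (lintegral_le_of_indepFun_of_pdf_le hW (hX j s hs)
    (hX j r hr) (indepFun_update_mixedPoint hX hind hs hr j) hpdf hc (Φ := S.indicator Ψ)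
    (hΨ.indicator hS) (K := K) fun w => ?_)
  · by_cases hω : ((fun i => X i s ω, fun i => X i r ω) : (Fin n → ℝ) × (Fin n → ℝ)) ∈
        windowSet n N η
    · rw [indicator_of_mem hω, indicator_of_mem]
      refine ⟨fun i => ?_, (hω j).1, (hω j).2.1, (hω j).2.2⟩
      rcases eq_or_ne i j with rfl | hij
      · simp [hN]
      · simp only [Function.update_of_ne hij]
        exact mixedPoint_mem_Icc (fun i => (hω i).1) (fun i => (hω i).2.1) i
    · rw [indicator_of_notMem hω]; exact zero_le
  · by_cases hw : ∀ i, w i ∈ Icc (-N) N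
    · obtain ⟨D, hDm, hDK, hDb⟩ := hD w hw
      refine ⟨(Icc (-N) N).indicator D, hDm.indicator measurableSet_Icc, ?_, fun y z => ?_⟩
      · rwa [lintegral_indicator measurableSet_Icc]
      · by_cases hq : (w, y, z) ∈ S
        · rw [indicator_of_mem hq, indicator_of_mem hq.2.1]
          exact hDb y hq.2.1 z hq.2.2.1 hq.2.2.2
        · rw [indicator_of_notMem hq]; exact zero_le
    · refine ⟨0, measurable_const, by simp, fun y z => ?_⟩
      rw [indicator_of_notMem]
      · exact zero_le
      · exact fun hq => hw hq.1

theorem measurable_update_of_prod (j : Fin n) {E : Type*} [MeasurableSpace E] {w : E → Fin n → ℝ}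
    {y : E → ℝ} (hw : Measurable w) (hy : Measurable y) :
    Measurable fun e => Function.update (w e) j (y e) := by
  refine measurable_pi_lambda _ fun i => ?_
  rcases eq_or_ne i j with rfl | h
  · simpa using hy
  · simp only [Function.update_of_ne h]
    exact (measurable_pi_apply i).comp hw

theorem lintegral_mixedPoint_increment_le [IsProbabilityMeasure P]
    (hX : ∀ k, ∀ t ∈ Icc 0 T, Measurable (X k t))
    (hind : iIndepFun (fun k ω (t : Icc (0 : ℝ) T) => X k t ω) P) {s r : ℝ} (hs : s ∈ Icc 0 T)
    (hr : r ∈ Icc 0 T) {j : Fin n} (hpdf : HasPDF (X j s) P volume) {c : ℝ≥0∞}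
    (hc : ∀ᵐ y ∂(volume : Measure ℝ), pdf (X j s) P volume y ≤ c) {N η : ℝ} (hN : 0 ≤ N)
    (hη : 0 ≤ η) {h : (Fin n → ℝ) → ℝ} (hm : Measurable h) {C : ℝ≥0}
    (hC : ∀ (j : Fin n) (x : Fin n → ℝ), (∀ i, x i ∈ Icc (-N) N) →
      eVariationOn (fun u => h (Function.update x j u)) (Icc (-N) N) ≤ C) :
    ∫⁻ ω, (windowSet n N η).indicator (fun p => ENNReal.ofReal
      |h (mixedPoint (j + 1) p.1 p.2) - h (mixedPoint j p.1 p.2)|)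
      (fun i => X i s ω, fun i => X i r ω) ∂P ≤ c * ENNReal.ofReal (2 * η * C) := by
  have := lintegral_indicator_windowSet_le hX hind hs hr hpdf hc (η := η) hN
    (Ψ := fun q => ENNReal.ofReal
      |h (Function.update q.1 j q.2.2) - h (Function.update q.1 j q.2.1)|)
    (by
      have h1 := hm.comp (measurable_update_of_prod j (measurable_fst (α := Fin n → ℝ) (β := ℝ × ℝ))
        (measurable_snd.comp measurable_snd))
      have h2 := hm.comp (measurable_update_of_prod j (measurable_fst (α := Fin n → ℝ) (β := ℝ × ℝ))
        (measurable_fst.comp measurable_snd))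
      exact ((measurable_norm.comp (h1.sub h2))).ennreal_ofReal)
    (K := ENNReal.ofReal (2 * η * C)) (fun w hw => by
      obtain ⟨D, hD, hD0, hDi, hDb⟩ := exists_window_bound hN hη (hC j w hw)
      refine ⟨fun y => ENNReal.ofReal (D y), hD.ennreal_ofReal, hDi, fun y hy z hz hyz => ?_⟩
      rw [abs_sub_comm]
      exact ENNReal.ofReal_le_ofReal (hDb y hy z hz hyz))
  simpa only [Function.update_idem, update_mixedPoint_succ, update_mixedPoint_self] using this

/-- By the mean value inequality the remainder is at most D(y) |z - y| ≤ D(y) η, where D majorizes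
the oscillation of d around the base value y; a second factor η is thus gained over the increment
estimate. -/
theorem lintegral_mixedPoint_taylor_le [IsProbabilityMeasure P]
    (hX : ∀ k, ∀ t ∈ Icc 0 T, Measurable (X k t))
    (hind : iIndepFun (fun k ω (t : Icc (0 : ℝ) T) => X k t ω) P) {s r : ℝ} (hs : s ∈ Icc 0 T)
    (hr : r ∈ Icc 0 T) {k : Fin n} (hpdf : HasPDF (X k s) P volume) {c : ℝ≥0∞}
    (hc : ∀ᵐ y ∂(volume : Measure ℝ), pdf (X k s) P volume y ≤ c) {N η : ℝ} (hN : 0 ≤ N)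
    (hη : 0 ≤ η) {f : (Fin n → ℝ) → ℝ} (hf : Continuous f) {d : (Fin n → ℝ) → ℝ}
    (hd : ∀ x, HasLeftPartialDeriv f k x (d x)) {C : ℝ≥0}
    (hC : ∀ (j : Fin n) (x : Fin n → ℝ), (∀ i, x i ∈ Icc (-N) N) →
      eVariationOn (fun u => d (Function.update x j u)) (Icc (-N) N) ≤ C) :
    ∫⁻ ω, (windowSet n N η).indicator (fun p => ENNReal.ofReal
      |f (mixedPoint (k + 1) p.1 p.2) - f (mixedPoint k p.1 p.2) -
        d (mixedPoint k p.1 p.2) * (p.2 k - p.1 k)|)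
      (fun i => X i s ω, fun i => X i r ω) ∂P ≤ c * ENNReal.ofReal (2 * η * C * η) := by
  have hdm := measurable_of_hasLeftPartialDeriv hf hd
  have := lintegral_indicator_windowSet_le hX hind hs hr hpdf hc (η := η) hN
    (Ψ := fun q => ENNReal.ofReal
      |f (Function.update q.1 k q.2.2) - f (Function.update q.1 k q.2.1) -
        d (Function.update q.1 k q.2.1) * (q.2.2 - q.2.1)|)
    (by
      have m1 := measurable_update_of_prod k (measurable_fst (α := Fin n → ℝ) (β := ℝ × ℝ))
        (measurable_snd.comp measurable_snd)
      have m2 := measurable_update_of_prod k (measurable_fst (α := Fin n → ℝ) (β := ℝ × ℝ))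
        (measurable_fst.comp measurable_snd)
      have h1 := hf.measurable.comp m1
      have h2 := hf.measurable.comp m2
      have h3 := hdm.comp m2
      have h4 : Measurable fun q : (Fin n → ℝ) × ℝ × ℝ => q.2.2 - q.2.1 := by fun_prop
      exact (measurable_norm.comp ((h1.sub h2).sub (h3.mul h4))).ennreal_ofReal)
    (K := ENNReal.ofReal (2 * η * C * η)) (fun w hw => by
      obtain ⟨D, hD, hD0, hDi, hDb⟩ := exists_window_bound hN hη (hC k w hw)
      refine ⟨fun y => ENNReal.ofReal (D y * η), (hD.mul_const η).ennreal_ofReal, ?_,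
        fun y hy z hz hyz => ?_⟩
      · simp_rw [ENNReal.ofReal_mul (hD0 _)]
        rw [lintegral_mul_const _ hD.ennreal_ofReal, ENNReal.ofReal_mul (by positivity)]
        gcongr
      · refine ENNReal.ofReal_le_ofReal ?_
        refine (abs_sub_sub_mul_le_of_hasDerivWithinAt_Iic
          (F := fun v => f (Function.update w k v)) (F' := fun v => d (Function.update w k v))
          (M := D y) (hf.comp (continuous_const.update k continuous_id)) (fun v => ?_)
          fun v hv => ?_).trans ?_
        · simpa [HasLeftPartialDeriv] using hd (Function.update w k v)
        · rw [abs_sub_comm]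
          refine hDb y hy v (uIcc_subset_Icc hy hz hv) (le_trans ?_ hyz)
          rw [abs_sub_comm, abs_sub_comm y]
          exact abs_sub_left_of_mem_uIcc hv
        · rw [abs_sub_comm z]
          exact mul_le_mul_of_nonneg_left hyz (hD0 y))
  simpa only [Function.update_idem, update_mixedPoint_succ, update_mixedPoint_self] using this

end Windows

/-! ### Mean increments and Taylor remainders in all coordinates. -/

section Totals

variable {n : ℕ} {Ω : Type*} [MeasurableSpace Ω] {P : Measure Ω} {T : ℝ} {X : Fin n → ℝ → Ω → ℝ}

theorem lintegral_increment_le [IsProbabilityMeasure P]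
    (hX : ∀ k, ∀ t ∈ Icc 0 T, Measurable (X k t))
    (hind : iIndepFun (fun k ω (t : Icc (0 : ℝ) T) => X k t ω) P) {s r : ℝ} (hs : s ∈ Icc 0 T)
    (hr : r ∈ Icc 0 T) {c : Fin n → ℝ≥0∞} (hc : ∀ j, HasPDF (X j s) P volume ∧
      ∀ᵐ y ∂(volume : Measure ℝ), pdf (X j s) P volume y ≤ c j) {N η : ℝ} (hN : 0 ≤ N)
    (hη : 0 ≤ η) {h : (Fin n → ℝ) → ℝ} (hm : Measurable h) {C : ℝ≥0}
    (hC : ∀ (j : Fin n) (x : Fin n → ℝ), (∀ i, x i ∈ Icc (-N) N) →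
      eVariationOn (fun u => h (Function.update x j u)) (Icc (-N) N) ≤ C) :
    ∫⁻ ω, (windowSet n N η).indicator (fun p => ENNReal.ofReal |h p.1 - h p.2|)
      (fun i => X i s ω, fun i => X i r ω) ∂P ≤ (∑ j, c j) * ENNReal.ofReal (2 * η * C) := by
  have hXs : ∀ t ∈ Icc 0 T, Measurable fun ω => (fun i => X i t ω) := fun t ht =>
    measurable_pi_lambda _ fun i => hX i t ht
  have hF : ∀ j : ℕ, Measurable fun p : (Fin n → ℝ) × (Fin n → ℝ) => ENNReal.ofReal
      |h (mixedPoint (j + 1) p.1 p.2) - h (mixedPoint j p.1 p.2)| := fun j =>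
    (measurable_norm.comp ((hm.comp (measurable_mixedPoint _ measurable_fst measurable_snd)).sub
      (hm.comp (measurable_mixedPoint _ measurable_fst measurable_snd)))).ennreal_ofReal
  calc _ ≤ ∫⁻ ω, (∑ j : Fin n, (windowSet n N η).indicator (fun p => ENNReal.ofReal
      |h (mixedPoint (j + 1) p.1 p.2) - h (mixedPoint j p.1 p.2)|)
      (fun i => X i s ω, fun i => X i r ω)) ∂P := by
        refine lintegral_mono fun ω => ?_
        by_cases hω : ((fun i => X i s ω, fun i => X i r ω) : (Fin n → ℝ) × (Fin n → ℝ)) ∈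
          windowSet n N η
        · simp only [indicator_of_mem hω]
          rw [← ENNReal.ofReal_sum_of_nonneg fun _ _ => abs_nonneg _, abs_sub_comm,
            ← sum_mixedPoint_sub h]
          exact ENNReal.ofReal_le_ofReal (Finset.abs_sum_le_sum_abs _ _)
        · simp [indicator_of_notMem hω]
    _ = ∑ j : Fin n, ∫⁻ ω, (windowSet n N η).indicator (fun p => ENNReal.ofReal
      |h (mixedPoint (j + 1) p.1 p.2) - h (mixedPoint j p.1 p.2)|)
      (fun i => X i s ω, fun i => X i r ω) ∂P :=
        lintegral_finsetSum _ fun j _ => measurable_indicator_windowSet (hXs s hs) (hXs r hr)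
          measurable_const N (hF j)
    _ ≤ ∑ j, c j * ENNReal.ofReal (2 * η * C) := Finset.sum_le_sum fun j _ =>
        lintegral_mixedPoint_increment_le hX hind hs hr (hc j).1 (hc j).2 hN hη hm hC
    _ = _ := by rw [Finset.sum_mul]

theorem lintegral_taylor_le [IsProbabilityMeasure P]
    (hX : ∀ k, ∀ t ∈ Icc 0 T, Measurable (X k t))
    (hind : iIndepFun (fun k ω (t : Icc (0 : ℝ) T) => X k t ω) P) {s r : ℝ} (hs : s ∈ Icc 0 T)
    (hr : r ∈ Icc 0 T) {c : Fin n → ℝ≥0∞} (hc : ∀ j, HasPDF (X j s) P volume ∧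
      ∀ᵐ y ∂(volume : Measure ℝ), pdf (X j s) P volume y ≤ c j) {N η : ℝ} (hN : 0 ≤ N)
    (hη : 0 ≤ η) {f : (Fin n → ℝ) → ℝ} (hf : Continuous f) {df : Fin n → (Fin n → ℝ) → ℝ}
    (hdf : ∀ k x, HasLeftPartialDeriv f k x (df k x)) {C : ℝ≥0}
    (hC : ∀ (k j : Fin n) (x : Fin n → ℝ), (∀ i, x i ∈ Icc (-N) N) →
      eVariationOn (fun u => df k (Function.update x j u)) (Icc (-N) N) ≤ C) :
    ∫⁻ ω, (windowSet n N η).indicator (fun p => ENNReal.ofReal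
        |f p.2 - f p.1 - ∑ k, df k p.1 * (p.2 k - p.1 k)|)
      (fun i => X i s ω, fun i => X i r ω) ∂P ≤
      ((n + 1) * ∑ j, c j) * ENNReal.ofReal (2 * η * C * η) := by
  have hXs : ∀ t ∈ Icc 0 T, Measurable fun ω => (fun i => X i t ω) := fun t ht =>
    measurable_pi_lambda _ fun i => hX i t ht
  have hdm : ∀ k, Measurable (df k) := fun k => measurable_of_hasLeftPartialDeriv hf (hdf k)
  have hmix : ∀ j, Measurable fun p : (Fin n → ℝ) × (Fin n → ℝ) => mixedPoint j p.1 p.2 := fun j =>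
    measurable_mixedPoint _ measurable_fst measurable_snd
  let A : Fin n → (Fin n → ℝ) × (Fin n → ℝ) → ℝ := fun k p =>
    |f (mixedPoint (k + 1) p.1 p.2) - f (mixedPoint k p.1 p.2) -
        df k (mixedPoint k p.1 p.2) * (p.2 k - p.1 k)|
  let B : Fin n → Fin n → (Fin n → ℝ) × (Fin n → ℝ) → ℝ := fun k j p =>
    |df k (mixedPoint (j + 1) p.1 p.2) - df k (mixedPoint j p.1 p.2)|
  have hA : ∀ k, Measurable (A k) := fun k => measurable_norm.comp
    ((((hf.measurable.comp (hmix (k + 1))).sub (hf.measurable.comp (hmix k)))).sub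
      (((hdm k).comp (hmix k)).mul (by fun_prop)))
  have hB : ∀ k j, Measurable (B k j) := fun k j => measurable_norm.comp
    (((hdm k).comp (hmix (j + 1))).sub ((hdm k).comp (hmix j)))
  have hpt : ∀ p ∈ windowSet n N η, |f p.2 - f p.1 - ∑ k, df k p.1 * (p.2 k - p.1 k)| ≤
      ∑ k, (A k p + ∑ j, η * B k j p) := by
    intro p hp
    rw [← sum_mixedPoint_sub f p.1 p.2, ← Finset.sum_sub_distrib]
    refine (Finset.abs_sum_le_sum_abs _ _).trans (Finset.sum_le_sum fun k _ => ?_)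
    -- Telescoping produces the k-th derivative at a mixed point instead of the base point. The
    -- correction is η times increments of `df k`, which is again of order η² in mean.
    have e : f (mixedPoint (k + 1) p.1 p.2) - f (mixedPoint k p.1 p.2) -
        df k p.1 * (p.2 k - p.1 k) = (f (mixedPoint (k + 1) p.1 p.2) - f (mixedPoint k p.1 p.2) -
        df k (mixedPoint k p.1 p.2) * (p.2 k - p.1 k)) +
        (p.2 k - p.1 k) * (df k (mixedPoint k p.1 p.2) - df k p.1) := by ring
    rw [e]
    refine (abs_add_le _ _).trans (add_le_add le_rfl ?_)
    rw [abs_mul, ← Finset.mul_sum, abs_sub_comm]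
    exact mul_le_mul (hp k).2.2 (abs_mixedPoint_sub_le (df k) p.1 p.2 k) (abs_nonneg _) hη
  have hind' : ∀ {F : (Fin n → ℝ) × (Fin n → ℝ) → ℝ≥0∞}, Measurable F →
      Measurable fun ω => (windowSet n N η).indicator F (fun i => X i s ω, fun i => X i r ω) :=
    fun hF => measurable_indicator_windowSet (hXs s hs) (hXs r hr) measurable_const N hF
  calc _ ≤ ∫⁻ ω, ∑ k : Fin n, ((windowSet n N η).indicator (fun p => ENNReal.ofReal (A k p))
        (fun i => X i s ω, fun i => X i r ω) + ∑ j : Fin n, ENNReal.ofReal η *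
          (windowSet n N η).indicator (fun p => ENNReal.ofReal (B k j p))
        (fun i => X i s ω, fun i => X i r ω)) ∂P := by
        refine lintegral_mono fun ω => ?_
        by_cases hω : ((fun i => X i s ω, fun i => X i r ω) : (Fin n → ℝ) × (Fin n → ℝ)) ∈
          windowSet n N η
        · simp only [indicator_of_mem hω]
          refine (ENNReal.ofReal_le_ofReal (hpt _ hω)).trans (le_of_eq ?_)
          rw [ENNReal.ofReal_sum_of_nonneg fun k _ => add_nonneg (abs_nonneg _)
            (Finset.sum_nonneg fun j _ => mul_nonneg hη (abs_nonneg _))]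
          refine Finset.sum_congr rfl fun k _ => ?_
          rw [ENNReal.ofReal_add (abs_nonneg _)
            (Finset.sum_nonneg fun j _ => mul_nonneg hη (abs_nonneg _)),
            ENNReal.ofReal_sum_of_nonneg fun j _ => mul_nonneg hη (abs_nonneg _)]
          simp_rw [ENNReal.ofReal_mul hη]
          rfl
        · simp [indicator_of_notMem hω]
    _ = ∑ k : Fin n, (∫⁻ ω, (windowSet n N η).indicator (fun p => ENNReal.ofReal (A k p))
        (fun i => X i s ω, fun i => X i r ω) ∂P + ∑ j : Fin n, ENNReal.ofReal η *
          ∫⁻ ω, (windowSet n N η).indicator (fun p => ENNReal.ofReal (B k j p))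
        (fun i => X i s ω, fun i => X i r ω) ∂P) := by
        have m1 := fun k => hind' (hA k).ennreal_ofReal
        have m2 := fun k j => hind' (hB k j).ennreal_ofReal
        refine (lintegral_finsetSum _ fun k _ => ?_).trans (Finset.sum_congr rfl fun k _ => ?_)
        · exact (m1 k).add (Finset.measurable_sum _ fun j _ => (m2 k j).const_mul _)
        rw [lintegral_add_left (m1 k), lintegral_finsetSum _ fun j _ => (m2 k j).const_mul _]
        congr 1
        exact Finset.sum_congr rfl fun j _ => lintegral_const_mul _ (m2 k j)
    -- The one-coordinate remainders contribute Σ c once and the corrections n times, whence the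
    -- factor n + 1.
    _ ≤ ∑ k : Fin n, (c k * ENNReal.ofReal (2 * η * C * η) +
        ∑ j : Fin n, ENNReal.ofReal η * (c j * ENNReal.ofReal (2 * η * C))) := by
        gcongr with k _ j _
        · exact lintegral_mixedPoint_taylor_le hX hind hs hr (hc k).1 (hc k).2 hN hη hf (hdf k) (hC k)
        · exact lintegral_mixedPoint_increment_le hX hind hs hr (hc j).1 (hc j).2 hN hη (hdm k) (hC k)
    _ = _ := by
        rw [ENNReal.ofReal_mul (by positivity : 0 ≤ 2 * η * (C : ℝ)), Finset.sum_add_distrib]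
        simp only [← Finset.sum_mul, ← Finset.mul_sum, Finset.sum_const, Finset.card_univ,
          Fintype.card_fin, nsmul_eq_mul]
        ring

end Totals

/-! ### A jointly measurable version with clamped time. -/

/-- Jointly measurable modification of a process with regular paths, with time clamped to
`[0, T]`. -/
theorem exists_measurable_modification {n : ℕ} {Ω : Type*} [MeasurableSpace Ω] {P : Measure Ω}
    {T : ℝ} (hT : 0 ≤ T) {X : Fin n → ℝ → Ω → ℝ} (hX : ∀ k, ∀ t ∈ Icc 0 T, Measurable (X k t))
    (hcont : ∀ k, ∀ᵐ ω ∂P, ContinuousOn (fun t => X k t ω) (Icc 0 T)) :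
    ∃ Y : ℝ → Ω → Fin n → ℝ, Measurable (Function.uncurry Y) ∧
      ∀ᵐ ω ∂P, ∀ t i, Y t ω i = X i (max 0 (min t T)) ω := by
  have hclamp : ∀ t, max 0 (min t T) ∈ Icc 0 T := fun t =>
    ⟨le_max_left _ _, max_le hT (min_le_right _ _)⟩
  let G : Set Ω := {ω | ∀ k, ContinuousOn (fun t => X k t ω) (Icc 0 T)}
  -- The set of regular paths need not be measurable; the complement of a measurable hull of its
  -- complement is, and still has full measure.
  let S : Set Ω := (toMeasurable P Gᶜ)ᶜ
  have hS : MeasurableSet S := (measurableSet_toMeasurable _ _).compl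
  have hSG : S ⊆ G := compl_subset_comm.1 (subset_toMeasurable P Gᶜ)
  have hSae : ∀ᵐ ω ∂P, ω ∈ S := by
    rw [ae_iff]
    have : {ω | ¬ω ∈ S} = toMeasurable P Gᶜ := by ext; simp [S]
    rw [this, measure_toMeasurable]
    exact ae_iff.1 (ae_all_iff.2 hcont)
  classical
  let Y : ℝ → Ω → Fin n → ℝ := fun t ω => if ω ∈ S then fun i => X i (max 0 (min t T)) ω else 0
  refine ⟨Y, ?_, ?_⟩
  · refine measurable_uncurry_of_continuous_of_measurable (fun ω => ?_) fun t => ?_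
    · by_cases hω : ω ∈ S
      · simp only [Y, hω, if_true]
        refine continuous_pi fun i => ?_
        exact (hSG hω i).comp_continuous (f := fun t => max 0 (min t T)) (by fun_prop) hclamp
      · simp only [Y, hω, if_false]
        exact continuous_const
    · exact Measurable.ite hS (measurable_pi_lambda _ fun i => hX i _ (hclamp t)) measurable_const
  · filter_upwards [hSae] with ω hω t i
    simp [Y, hω]

/-! ### Almost sure bounds along the paths. -/

section AlmostSure

variable {n : ℕ} {Ω : Type*} [MeasurableSpace Ω] {P : Measure Ω}
  {T : ℝ} {X : Fin n → ℝ → Ω → ℝ}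

theorem exists_density_bounds (hdens : ∀ k, HasIntegrablyBoundedDensities P T (X k)) :
    ∃ c : Fin n → ℝ → ℝ≥0∞,
      (∀ᵐ s ∂volume.restrict (Ioo 0 T), ∀ j, HasPDF (X j s) P volume ∧
        ∀ᵐ y ∂(volume : Measure ℝ), pdf (X j s) P volume y ≤ c j s) ∧
      ∫⁻ s in Ioo 0 T, ∑ j, c j s < ∞ := by
  choose g hgi hg using hdens
  have hle : volume.restrict (Ioo 0 T) ≤ volume.restrict (Icc 0 T) :=
    Measure.restrict_mono Ioo_subset_Icc_self le_rfl
  refine ⟨fun j s => ENNReal.ofReal (g j s), ?_, ?_⟩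
  · exact ae_all_iff.2 fun j => ae_mono hle (hg j)
  · have hgi' : ∀ j, IntegrableOn (g j) (Ioo 0 T) := fun j => (hgi j).mono_set Ioo_subset_Icc_self
    rw [lintegral_finsetSum' _ fun j _ => (hgi' j).1.aemeasurable.ennreal_ofReal]
    exact ENNReal.sum_lt_top.2 fun j _ => lt_of_le_of_lt
      (lintegral_mono fun s => Real.ofReal_le_enorm (g j s)) (hgi' j).2

theorem lintegral_ofReal_sub_rpow_le {p s T : ℝ} (hp : -1 < p) (hs : s ∈ Ioo 0 T) :
    ∫⁻ u in Ioo 0 s, ENNReal.ofReal ((s - u) ^ p) ≤ ENNReal.ofReal (T ^ (p + 1) / (p + 1)) := by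
  have hi := intervalIntegrable_sub_rpow' hp s 0 s
  rw [intervalIntegrable_iff_integrableOn_Ioo_of_le hs.1.le] at hi
  have hp1 : 0 < p + 1 := by linarith
  rw [← ofReal_integral_eq_lintegral_ofReal hi, ← intervalIntegral_eq_setIntegral_Ioo hs.1.le,
    integral_sub_rpow' hp, sub_zero]
  · have := hs.1.le
    have := hs.2.le
    gcongr
  · filter_upwards [ae_restrict_mem measurableSet_Ioo] with u hu
    exact Real.rpow_nonneg (sub_nonneg.2 hu.2.le) _

/-- The mean of the double integral is controlled by ∫ Σ c times ∫ (s-u)^(α-1-β) du, finite since β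
< α. The window with fixed N is needed because the random Hölder constants need not have moments. -/
theorem ae_lintegral_increment_lt_top [IsProbabilityMeasure P]
    (hX : ∀ k, ∀ t ∈ Icc 0 T, Measurable (X k t))
    (hind : iIndepFun (fun k ω (t : Icc (0 : ℝ) T) => X k t ω) P)
    {c : Fin n → ℝ → ℝ≥0∞} (hc : ∀ᵐ s ∂volume.restrict (Ioo 0 T), ∀ j, HasPDF (X j s) P volume ∧
        ∀ᵐ y ∂(volume : Measure ℝ), pdf (X j s) P volume y ≤ c j s)
    (hci : ∫⁻ s in Ioo 0 T, ∑ j, c j s < ∞)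
    {Y : ℝ → Ω → Fin n → ℝ} (hY : Measurable (Function.uncurry Y))
    (hYX : ∀ᵐ ω ∂P, ∀ t i, Y t ω i = X i (max 0 (min t T)) ω)
    {α β : ℝ} (hβα : β < α) {N : ℝ} (hN : 0 ≤ N) {h : (Fin n → ℝ) → ℝ} (hm : Measurable h)
    (hh : LocallyBVInEachVariable h) :
    ∀ᵐ ω ∂P, ∫⁻ s in Ioo 0 T, ∫⁻ u in Ioo 0 T, (if u < s then
      (windowSet n N (N * (s - u) ^ α)).indicator (fun p => ENNReal.ofReal |h p.1 - h p.2|)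
        (Y s ω, Y u ω) * ENNReal.ofReal ((s - u) ^ (-(1 + β))) else 0) < ∞ := by
  obtain ⟨C, hC⟩ := hh N
  let F : ℝ → ℝ → Ω → ℝ≥0∞ := fun s u ω => if u < s then
      (windowSet n N (N * (s - u) ^ α)).indicator (fun p => ENNReal.ofReal |h p.1 - h p.2|)
        (Y s ω, Y u ω) * ENNReal.ofReal ((s - u) ^ (-(1 + β))) else 0
  have hF : Measurable fun q : ℝ × ℝ × Ω => F q.1 q.2.1 q.2.2 := by
    refine Measurable.ite (measurableSet_lt (by fun_prop) (by fun_prop)) (Measurable.mul ?_ ?_)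
      measurable_const
    · exact measurable_indicator_windowSet (x := fun q : ℝ × ℝ × Ω => Y q.1 q.2.2)
        (y := fun q : ℝ × ℝ × Ω => Y q.2.1 q.2.2) (η := fun q => N * (q.1 - q.2.1) ^ α)
        (hY.comp (measurable_fst.prodMk (measurable_snd.comp measurable_snd)))
        (hY.comp measurable_snd) (by fun_prop) N
        (measurable_norm.comp ((hm.comp measurable_fst).sub (hm.comp measurable_snd))).ennreal_ofReal
    · fun_prop
  have hFω : Measurable fun q : Ω × ℝ => ∫⁻ u in Ioo 0 T, F q.2 u q.1 :=
    Measurable.lintegral_prod_right' (f := fun r : (Ω × ℝ) × ℝ => F r.1.2 r.2 r.1.1)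
      (hF.comp (by fun_prop : Measurable fun r : (Ω × ℝ) × ℝ => (r.1.2, r.2, r.1.1)))
  refine ae_lt_top (hFω.lintegral_prod_right') (ne_of_lt ?_)
  have hclamp : ∀ t ∈ Ioo 0 T, max 0 (min t T) = t := fun t ht => by
    rw [min_eq_left ht.2.le, max_eq_right ht.1.le]
  have hbound : ∀ᵐ s ∂volume.restrict (Ioo 0 T), ∫⁻ u in Ioo 0 T, ∫⁻ ω, F s u ω ∂P ≤
      (∑ j, c j s) * (ENNReal.ofReal (2 * N * C) *
        ENNReal.ofReal (T ^ (α - (1 + β) + 1) / (α - (1 + β) + 1))) := by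
    filter_upwards [hc, ae_restrict_mem measurableSet_Ioo] with s hcs hs
    have h1 : ∀ u ∈ Ioo 0 T, ∫⁻ ω, F s u ω ∂P ≤ (Iio s).indicator (fun u => (∑ j, c j s) *
        (ENNReal.ofReal (2 * N * C) * ENNReal.ofReal ((s - u) ^ (α - (1 + β))))) u := by
      intro u hu
      by_cases hus : u < s
      · have hsu : 0 < s - u := sub_pos.2 hus
        rw [indicator_of_mem (mem_Iio.2 hus)]
        calc ∫⁻ ω, F s u ω ∂P = ∫⁻ ω, (windowSet n N (N * (s - u) ^ α)).indicator
              (fun p => ENNReal.ofReal |h p.1 - h p.2|) (fun i => X i s ω, fun i => X i u ω) *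
                ENNReal.ofReal ((s - u) ^ (-(1 + β))) ∂P := by
              refine lintegral_congr_ae ?_
              filter_upwards [hYX] with ω hω
              have e : ∀ t ∈ Ioo 0 T, Y t ω = fun i => X i t ω := fun t ht => by
                ext i; rw [hω, hclamp t ht]
              simp only [F, hus, if_true, e s hs, e u hu]
          _ = (∫⁻ ω, (windowSet n N (N * (s - u) ^ α)).indicator
              (fun p => ENNReal.ofReal |h p.1 - h p.2|) (fun i => X i s ω, fun i => X i u ω) ∂P) *
                ENNReal.ofReal ((s - u) ^ (-(1 + β))) :=
              lintegral_mul_const' _ _ ENNReal.ofReal_ne_top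
          _ ≤ ((∑ j, c j s) * ENNReal.ofReal (2 * (N * (s - u) ^ α) * C)) *
                ENNReal.ofReal ((s - u) ^ (-(1 + β))) := by
              gcongr
              exact lintegral_increment_le hX hind (Ioo_subset_Icc_self hs)
                (Ioo_subset_Icc_self hu) hcs hN (by positivity) hm hC
          _ = _ := by
              rw [mul_assoc, ← ENNReal.ofReal_mul (by positivity), ← ENNReal.ofReal_mul (by positivity),
                sub_eq_add_neg α, Real.rpow_add hsu]
              congr 2; ring
      · simp [F, hus]
    calc ∫⁻ u in Ioo 0 T, ∫⁻ ω, F s u ω ∂P ≤ ∫⁻ u in Ioo 0 T,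
          (Iio s).indicator (fun u => (∑ j, c j s) *
          (ENNReal.ofReal (2 * N * C) * ENNReal.ofReal ((s - u) ^ (α - (1 + β))))) u :=
          setLIntegral_mono' measurableSet_Ioo h1
      _ ≤ ∫⁻ u in Ioo 0 s, (∑ j, c j s) *
          (ENNReal.ofReal (2 * N * C) * ENNReal.ofReal ((s - u) ^ (α - (1 + β)))) := by
          rw [lintegral_indicator measurableSet_Iio, Measure.restrict_restrict measurableSet_Iio]
          exact lintegral_mono_set fun u hu => ⟨hu.2.1, hu.1⟩
      _ = (∑ j, c j s) * (ENNReal.ofReal (2 * N * C) *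
          ∫⁻ u in Ioo 0 s, ENNReal.ofReal ((s - u) ^ (α - (1 + β)))) := by
          rw [lintegral_const_mul _ (by fun_prop), lintegral_const_mul _ (by fun_prop)]
      _ ≤ _ := by
          gcongr
          exact lintegral_ofReal_sub_rpow_le (by linarith) hs
  calc ∫⁻ ω, (∫⁻ s in Ioo 0 T, ∫⁻ u in Ioo 0 T, F s u ω) ∂P
      = ∫⁻ s in Ioo 0 T, ∫⁻ ω, (∫⁻ u in Ioo 0 T, F s u ω) ∂P :=
        lintegral_lintegral_swap (f := fun ω s => ∫⁻ u in Ioo 0 T, F s u ω) hFω.aemeasurable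
    _ = ∫⁻ s in Ioo 0 T, ∫⁻ u in Ioo 0 T, ∫⁻ ω, F s u ω ∂P := by
        refine lintegral_congr fun s =>
          lintegral_lintegral_swap (f := fun ω u => F s u ω) ?_
        exact (hF.comp (by fun_prop : Measurable fun r : Ω × ℝ => (s, r.2, r.1))).aemeasurable
    _ ≤ ∫⁻ s in Ioo 0 T, (∑ j, c j s) * (ENNReal.ofReal (2 * N * C) *
        ENNReal.ofReal (T ^ (α - (1 + β) + 1) / (α - (1 + β) + 1))) := lintegral_mono_ae hbound
    _ = (∫⁻ s in Ioo 0 T, ∑ j, c j s) * (ENNReal.ofReal (2 * N * C) *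
        ENNReal.ofReal (T ^ (α - (1 + β) + 1) / (α - (1 + β) + 1))) :=
        lintegral_mul_const' _ _ (ENNReal.mul_ne_top ENNReal.ofReal_ne_top ENNReal.ofReal_ne_top)
    _ < ∞ := ENNReal.mul_lt_top hci (ENNReal.mul_lt_top ENNReal.ofReal_lt_top ENNReal.ofReal_lt_top)

/-- The means decay geometrically in m, so the series of the integrals has finite mean and almost
surely its terms tend to 0. -/
theorem ae_tendsto_lintegral_taylor [IsProbabilityMeasure P]
    (hX : ∀ k, ∀ t ∈ Icc 0 T, Measurable (X k t))
    (hind : iIndepFun (fun k ω (t : Icc (0 : ℝ) T) => X k t ω) P)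
    {c : Fin n → ℝ → ℝ≥0∞} (hc : ∀ᵐ s ∂volume.restrict (Ioo 0 T), ∀ j, HasPDF (X j s) P volume ∧
        ∀ᵐ y ∂(volume : Measure ℝ), pdf (X j s) P volume y ≤ c j s)
    (hci : ∫⁻ s in Ioo 0 T, ∑ j, c j s < ∞) (hT : 0 ≤ T)
    {Y : ℝ → Ω → Fin n → ℝ} (hY : Measurable (Function.uncurry Y))
    (hYX : ∀ᵐ ω ∂P, ∀ t i, Y t ω i = X i (max 0 (min t T)) ω)
    {α : ℝ} (hα : 1 / 2 < α) {N : ℝ} (hN : 0 ≤ N)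
    {f : (Fin n → ℝ) → ℝ} (hf : Continuous f) {df : Fin n → (Fin n → ℝ) → ℝ}
    (hdf : ∀ k x, HasLeftPartialDeriv f k x (df k x)) (hbv : ∀ k, LocallyBVInEachVariable (df k)) :
    ∀ᵐ ω ∂P, Tendsto (fun m : ℕ => ∫⁻ s in Ioo 0 T,
      (windowSet n N (N * ((1 / 2 : ℝ) ^ m) ^ α)).indicator (fun p => ENNReal.ofReal
        |f p.2 - f p.1 - ∑ k, df k p.1 * (p.2 k - p.1 k)|)
        (Y s ω, Y (s + (1 / 2 : ℝ) ^ m) ω) * ENNReal.ofReal (((1 / 2 : ℝ) ^ m)⁻¹)) atTop (𝓝 0) := by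
  choose C' hC' using fun k => hbv k N
  let C : ℝ≥0 := ∑ k, C' k
  have hC : ∀ (k j : Fin n) (x : Fin n → ℝ), (∀ i, x i ∈ Icc (-N) N) →
      eVariationOn (fun u => df k (Function.update x j u)) (Icc (-N) N) ≤ C := fun k j x hx =>
    (hC' k j x hx).trans (ENNReal.coe_le_coe.2
      (Finset.single_le_sum (f := C') (fun _ _ => zero_le) (Finset.mem_univ k)))
  have hdm : ∀ k, Measurable (df k) := fun k => measurable_of_hasLeftPartialDeriv hf (hdf k)
  let δ : ℕ → ℝ := fun m => (1 / 2 : ℝ) ^ m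
  have hδ : ∀ m, 0 < δ m := fun m => by positivity
  let R : (Fin n → ℝ) × (Fin n → ℝ) → ℝ≥0∞ := fun p => ENNReal.ofReal
        |f p.2 - f p.1 - ∑ k, df k p.1 * (p.2 k - p.1 k)|
  have hR : Measurable R := (measurable_norm.comp (((hf.measurable.comp measurable_snd).sub
    (hf.measurable.comp measurable_fst)).sub (Finset.measurable_sum _ fun k _ =>
      ((hdm k).comp measurable_fst).mul (by fun_prop)))).ennreal_ofReal
  let F : ℕ → ℝ → Ω → ℝ≥0∞ := fun m s ω =>
    (windowSet n N (N * (δ m) ^ α)).indicator R (Y s ω, Y (s + δ m) ω) * ENNReal.ofReal ((δ m)⁻¹)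
  have hF : ∀ m, Measurable fun q : Ω × ℝ => F m q.2 q.1 := fun m => by
    refine Measurable.mul_const ?_ _
    exact measurable_indicator_windowSet (x := fun q : Ω × ℝ => Y q.2 q.1)
      (y := fun q : Ω × ℝ => Y (q.2 + δ m) q.1) (η := fun _ => N * (δ m) ^ α)
      (hY.comp measurable_swap)
      (hY.comp (by fun_prop : Measurable fun q : Ω × ℝ => (q.2 + δ m, q.1))) measurable_const N hR
  -- The time s + δ may exceed T. After clamping it is just some second time in [0,T], and the
  -- estimate does not care which.
  have hclamp' : ∀ t, max 0 (min t T) ∈ Icc 0 T := fun t =>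
    ⟨le_max_left _ _, max_le hT (min_le_right _ _)⟩
  -- Two window widths divided by δ give δ^(2α-1), that is q^m; here q < 1 is exactly the condition
  -- α > 1/2.
  let q : ℝ := (1 / 2 : ℝ) ^ (2 * α - 1)
  have hq0 : 0 ≤ q := by positivity
  have hq1 : q < 1 := Real.rpow_lt_one (by norm_num) (by norm_num) (by linarith)
  have hexp : ∀ m, ∫⁻ ω, (∫⁻ s in Ioo 0 T, F m s ω) ∂P ≤
      (((n + 1) * ∫⁻ s in Ioo 0 T, ∑ j, c j s) * ENNReal.ofReal (2 * N * N * C)) *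
        (ENNReal.ofReal q) ^ m := by
    intro m
    rw [lintegral_lintegral_swap (f := fun ω s => F m s ω) (hF m).aemeasurable]
    have hb : ∀ᵐ s ∂volume.restrict (Ioo 0 T), ∫⁻ ω, F m s ω ∂P ≤
        ((n + 1) * ∑ j, c j s) * (ENNReal.ofReal (2 * N * N * C) * (ENNReal.ofReal q) ^ m) := by
      filter_upwards [hc, ae_restrict_mem measurableSet_Ioo] with s hcs hs
      calc ∫⁻ ω, F m s ω ∂P = ∫⁻ ω, (windowSet n N (N * (δ m) ^ α)).indicator R
              (fun i => X i s ω, fun i => X i (max 0 (min (s + δ m) T)) ω) *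
                ENNReal.ofReal ((δ m)⁻¹) ∂P := by
              refine lintegral_congr_ae ?_
              filter_upwards [hYX] with ω hω
              have e1 : Y s ω = fun i => X i s ω := by
                ext i; rw [hω, min_eq_left hs.2.le, max_eq_right hs.1.le]
              have e2 : Y (s + δ m) ω = fun i => X i (max 0 (min (s + δ m) T)) ω := by
                ext i; rw [hω]
              simp only [F, e1, e2]
          _ = (∫⁻ ω, (windowSet n N (N * (δ m) ^ α)).indicator R
              (fun i => X i s ω, fun i => X i (max 0 (min (s + δ m) T)) ω) ∂P) *
                ENNReal.ofReal ((δ m)⁻¹) := lintegral_mul_const' _ _ ENNReal.ofReal_ne_top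
          _ ≤ (((n + 1) * ∑ j, c j s) *
                ENNReal.ofReal (2 * (N * (δ m) ^ α) * C * (N * (δ m) ^ α))) *
                ENNReal.ofReal ((δ m)⁻¹) := by
              gcongr
              have := hδ m
              exact lintegral_taylor_le hX hind (Ioo_subset_Icc_self hs) (hclamp' _) hcs hN
                (by positivity) hf hdf hC
          _ = _ := by
              have := hδ m
              rw [mul_assoc, ← ENNReal.ofReal_mul (by positivity), ← ENNReal.ofReal_pow hq0,
                ← ENNReal.ofReal_mul (by positivity)]
              have e : q ^ m = (δ m) ^ α * (δ m) ^ α * (δ m)⁻¹ := by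
                rw [← Real.rpow_neg_one (δ m), ← Real.rpow_add this, ← Real.rpow_add this]
                simp only [q, δ]
                rw [← Real.rpow_natCast, ← Real.rpow_natCast, ← Real.rpow_mul (by norm_num),
                  ← Real.rpow_mul (by norm_num)]
                congr 1; ring
              rw [e]
              congr 2; ring
    refine (lintegral_mono_ae hb).trans (le_of_eq ?_)
    rw [lintegral_mul_const' _ _ (ENNReal.mul_ne_top ENNReal.ofReal_ne_top
      (ENNReal.pow_ne_top ENNReal.ofReal_ne_top)), lintegral_const_mul' _ _ (by finiteness)]
    ring
  have hsum : ∫⁻ ω, (∑' m, ∫⁻ s in Ioo 0 T, F m s ω) ∂P ≠ ∞ := by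
    rw [lintegral_tsum fun m => (hF m).lintegral_prod_right'.aemeasurable]
    refine ne_top_of_le_ne_top ?_ (ENNReal.tsum_le_tsum hexp)
    rw [ENNReal.tsum_mul_left, ENNReal.tsum_geometric]
    refine ENNReal.mul_ne_top (ENNReal.mul_ne_top (ENNReal.mul_ne_top (by finiteness) hci.ne)
      ENNReal.ofReal_ne_top) ?_
    rw [ENNReal.inv_ne_top]
    exact (tsub_pos_of_lt (by rw [← ENNReal.ofReal_one]; exact
      (ENNReal.ofReal_lt_ofReal_iff one_pos).2 hq1)).ne'
  filter_upwards [ae_lt_top' (AEMeasurable.tsum fun m =>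
    (hF m).lintegral_prod_right'.aemeasurable) hsum] with ω hω
  exact ENNReal.tendsto_atTop_zero_of_tsum_ne_top hω.ne

end AlmostSure

/-! ### Membership in the Besov spaces and existence of the integral. -/

theorem MemBesovTwo.congr {T β : ℝ} {h h' : ℝ → ℝ} (hh : MemBesovTwo T β h)
    (e : EqOn h h' (Icc 0 T)) : MemBesovTwo T β h' := by
  refine ⟨?_, ?_⟩
  · convert hh.1 using 2 with t
    exact (e t.2).symm
  · convert hh.2 using 2
    · refine setLIntegral_congr_fun measurableSet_Ioo fun s hs => ?_
      rw [e (Ioo_subset_Icc_self hs)]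
    · refine setLIntegral_congr_fun measurableSet_Ioo fun s hs => ?_
      refine setLIntegral_congr_fun measurableSet_Ioo fun u hu => ?_
      rw [e (Ioo_subset_Icc_self hs), e ⟨hu.1.le, (hu.2.trans hs.2).le⟩]

theorem MemBesovOne.of_holder {T β γ C : ℝ} (hγ0 : 0 < γ) (hγ : 1 - β < γ) (hC : 0 ≤ C)
    {g g' : ℝ → ℝ} (hg : ∀ s t, |g s - g t| ≤ C * |s - t| ^ γ) (e : EqOn g g' (Icc 0 T)) :
    MemBesovOne T (1 - β) g' := by
  have hp : 0 < γ - (1 - β) := by linarith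
  refine ⟨?_, ?_⟩
  · have h1 : Measurable fun t : Icc (0 : ℝ) T => g t :=
      (continuous_of_abs_sub_le_rpow hγ0 hg).measurable.comp measurable_subtype_coe
    convert h1 using 2 with t
    exact (e t.2).symm
  · refine lt_of_le_of_lt (b := ENNReal.ofReal (C * T ^ (γ - (1 - β))) +
      ENNReal.ofReal (C * (T ^ (γ - (1 - β)) / (γ - (1 - β))))) ?_ (by finiteness)
    refine iSup_le fun s => iSup_le fun t => iSup_le fun ⟨hs, hst, ht⟩ => ?_
    have hs' : s ∈ Icc 0 T := ⟨hs, hst.le.trans ht⟩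
    have ht' : t ∈ Icc 0 T := ⟨hs.trans hst.le, ht⟩
    have hpow : (t - s) ^ (γ - (1 - β)) ≤ T ^ (γ - (1 - β)) :=
      Real.rpow_le_rpow (by linarith) (by linarith) hp.le
    have key : ∀ u, s < u → ∀ p : ℝ, |g u - g s| / (u - s) ^ p ≤ C * (u - s) ^ (γ - p) := by
      intro u hu p
      have hu' : 0 < u - s := sub_pos.2 hu
      rw [Real.rpow_sub hu', ← mul_div_assoc]
      have := hg u s
      rw [abs_of_pos hu'] at this
      gcongr
    refine add_le_add (ENNReal.ofReal_le_ofReal ?_) ?_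
    · rw [← e hs', ← e ht']
      refine (key t hst _).trans ?_
      gcongr
    · calc _ ≤ ∫⁻ u in Ioo s t, ENNReal.ofReal (C * (u - s) ^ (γ - (1 - β) - 1)) := by
            refine setLIntegral_mono' measurableSet_Ioo fun u hu => ENNReal.ofReal_le_ofReal ?_
            rw [← e hs', ← e ⟨hs.trans hu.1.le, hu.2.le.trans ht⟩]
            refine (key u hu.1 _).trans (le_of_eq ?_)
            congr 2; ring
        _ = ENNReal.ofReal (∫ u in Ioo s t, C * (u - s) ^ (γ - (1 - β) - 1)) := by
            rw [ofReal_integral_eq_lintegral_ofReal]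
            · have := (intervalIntegrable_sub_rpow (p := γ - (1 - β) - 1) (by linarith) s s t).const_mul C
              rwa [intervalIntegrable_iff_integrableOn_Ioo_of_le hst.le] at this
            · filter_upwards [ae_restrict_mem measurableSet_Ioo] with u hu
              exact mul_nonneg hC (Real.rpow_nonneg (sub_nonneg.2 hu.1.le) _)
        _ ≤ _ := by
            refine ENNReal.ofReal_le_ofReal ?_
            rw [← intervalIntegral_eq_setIntegral_Ioo hst.le, intervalIntegral.integral_const_mul,
              integral_sub_rpow (by linarith), sub_add_cancel]
            gcongr

theorem glsIntegrand_congr {T β : ℝ} {h h' g g' : ℝ → ℝ} (eh : EqOn h h' (Icc 0 T))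
    (eg : EqOn g g' (Icc 0 T)) : EqOn (glsIntegrand T β h g) (glsIntegrand T β h' g') (Ioo 0 T) := by
  intro s hs
  have hs' := Ioo_subset_Icc_self hs
  have hT' : T ∈ Icc 0 T := ⟨(hs.1.trans hs.2).le, le_rfl⟩
  unfold glsIntegrand weylLeft weylRight
  have e1 : ∫ u in (0 : ℝ)..s, (h s - h u) / (s - u) ^ (β + 1) =
      ∫ u in (0 : ℝ)..s, (h' s - h' u) / (s - u) ^ (β + 1) := by
    refine intervalIntegral.integral_congr fun u hu => ?_
    rw [uIcc_of_le hs.1.le] at hu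
    simp only [eh hs', eh ⟨hu.1, hu.2.trans hs.2.le⟩]
  have e2 : ∫ u in s..T, ((g s - g T) - (g u - g T)) / (u - s) ^ (1 - β + 1) =
      ∫ u in s..T, ((g' s - g' T) - (g' u - g' T)) / (u - s) ^ (1 - β + 1) := by
    refine intervalIntegral.integral_congr fun u hu => ?_
    rw [uIcc_of_le hs.2.le] at hu
    simp only [eg hs', eg hT', eg ⟨hs.1.le.trans hu.1, hu.2⟩]
  dsimp only
  rw [e1, e2, eh hs', eg hs', eg hT']

/-- Only values on [0,T] matter, so a globally Hölder extension g can stand in for the actual path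
g'. -/
theorem HasGLSIntegral.of_holder {T β γ C : ℝ} (h0 : 0 < β) (h1 : β < 1)
    (hT : 0 < T) (hγ : 1 - β < γ) (hC : 0 ≤ C) {h h' g g' : ℝ → ℝ} (hm : Measurable h)
    (hh : MemBesovTwo T β h) (hg : ∀ s t, |g s - g t| ≤ C * |s - t| ^ γ)
    (eh : EqOn h h' (Icc 0 T)) (eg : EqOn g g' (Icc 0 T)) :
    HasGLSIntegral T β h' g' (glsIntegral T β h g) := by
  have ec := glsIntegrand_congr (β := β) eh eg
  refine ⟨hh.congr eh, MemBesovOne.of_holder (by linarith) hγ hC hg eg, ?_, ?_⟩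
  · have := hh.intervalIntegrable_glsIntegrand h0 h1 hT hγ hC hm hg
    rw [intervalIntegrable_iff_integrableOn_Ioo_of_le hT.le] at this ⊢
    exact this.congr_fun ec measurableSet_Ioo
  · rw [glsIntegral, glsIntegral, intervalIntegral_eq_setIntegral_Ioo hT.le,
      intervalIntegral_eq_setIntegral_Ioo hT.le, setIntegral_congr_fun measurableSet_Ioo ec]

theorem tendsto_steklov {φ : ℝ → ℝ} (hφ : Continuous φ) (s : ℝ) {δ : ℕ → ℝ} (hδ : ∀ n, 0 < δ n)
    (hlim : Tendsto δ atTop (𝓝 0)) : Tendsto (fun n => steklov (δ n) φ s) atTop (𝓝 (φ s)) := by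
  have hc : Continuous fun r => φ (s + r) := by fun_prop
  have h1 : HasDerivAt (fun δ => ∫ r in 0..δ, φ (s + r)) (φ (s + 0)) 0 :=
    intervalIntegral.integral_hasDerivAt_right (hc.intervalIntegrable _ _)
      (hc.stronglyMeasurableAtFilter _ _) hc.continuousAt
  rw [hasDerivAt_iff_tendsto_slope, add_zero] at h1
  have h2 : Tendsto δ atTop (𝓝[≠] 0) := tendsto_nhdsWithin_iff.2
    ⟨hlim, Eventually.of_forall fun n => (hδ n).ne'⟩
  refine (h1.comp h2).congr fun n => ?_
  simp [slope, steklov]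

/-- The integrand is the derivative of a Steklov average, so the integral is a difference of
averages at T and at 0. -/
theorem tendsto_integral_forward_difference {T : ℝ} {φ : ℝ → ℝ} (hφ : Continuous φ)
    {δ : ℕ → ℝ} (hδ : ∀ n, 0 < δ n) (hlim : Tendsto δ atTop (𝓝 0)) :
    Tendsto (fun n => ∫ s in 0..T, (φ (s + δ n) - φ s) / δ n) atTop (𝓝 (φ T - φ 0)) := by
  refine ((tendsto_steklov hφ T hδ hlim).sub (tendsto_steklov hφ 0 hδ hlim)).congr fun n => ?_
  refine (intervalIntegral.integral_eq_sub_of_hasDerivAt (fun s _ => hasDerivAt_steklov hφ s) ?_).symm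
  exact Continuous.intervalIntegrable (by fun_prop) _ _

/-- On (0,T) one has (s-u)^(-1-β) ≤ T^(β'-β) (s-u)^(-1-β'), so finiteness at one exponent covers all
smaller ones. Countably many exponents β', hence one null set, then serve every β. The term with
s^(-β) only needs h bounded and β < 1. -/
theorem memBesovTwo_of_lintegral_lt_top {n : ℕ} {T α β β' N B : ℝ} (hT : 0 ≤ T) (hβ1 : β < 1)
    (hββ' : β ≤ β') {x : ℝ → Fin n → ℝ} {h : (Fin n → ℝ) → ℝ} (hm : Measurable fun t => h (x t))
    (hB : ∀ t, |h (x t)| ≤ B)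
    (hx : ∀ s u, u < s → (x s, x u) ∈ windowSet n N (N * (s - u) ^ α))
    (hfin : ∫⁻ s in Ioo 0 T, ∫⁻ u in Ioo 0 T, (if u < s then
      (windowSet n N (N * (s - u) ^ α)).indicator (fun p => ENNReal.ofReal |h p.1 - h p.2|)
        (x s, x u) * ENNReal.ofReal ((s - u) ^ (-(1 + β'))) else 0) < ∞) :
    MemBesovTwo T β (fun t => h (x t)) := by
  refine ⟨hm.comp measurable_subtype_coe, ENNReal.add_lt_top.2 ⟨?_, ?_⟩⟩
  · have hi := (intervalIntegral.intervalIntegrable_rpow' (a := 0) (b := T)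
      (r := -β) (by linarith)).const_mul B
    rw [intervalIntegrable_iff_integrableOn_Ioo_of_le hT] at hi
    refine lt_of_le_of_lt ?_ hi.2
    refine setLIntegral_mono' measurableSet_Ioo fun s hs => ?_
    refine le_trans (ENNReal.ofReal_le_ofReal ?_) (Real.ofReal_le_enorm _)
    dsimp only
    rw [Real.rpow_neg hs.1.le, ← div_eq_mul_inv]
    have := Real.rpow_nonneg hs.1.le β
    gcongr
    exact hB s
  · refine lt_of_le_of_lt ?_ (ENNReal.mul_lt_top (ENNReal.ofReal_lt_top (r := T ^ (β' - β))) hfin)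
    rw [← lintegral_const_mul' _ _ ENNReal.ofReal_ne_top]
    refine setLIntegral_mono' measurableSet_Ioo fun s hs => ?_
    rw [← lintegral_const_mul' _ _ ENNReal.ofReal_ne_top]
    refine le_trans (setLIntegral_mono' measurableSet_Ioo fun u hu => ?_)
      (lintegral_mono_set (Ioo_subset_Ioo_right hs.2.le))
    have hsu : 0 < s - u := sub_pos.2 hu.2
    rw [if_pos hu.2, indicator_of_mem (hx s u hu.2), ← ENNReal.ofReal_mul (abs_nonneg _),
      ← ENNReal.ofReal_mul (by positivity)]
    refine ENNReal.ofReal_le_ofReal ?_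
    rw [div_eq_mul_inv, ← Real.rpow_neg hsu.le, show -(1 + β) = (β' - β) + -(1 + β') by ring,
      Real.rpow_add hsu, mul_left_comm]
    gcongr
    linarith [hu.1, hs.2]

/-! ### The change of variables formula along a fixed path. -/

/-- Pathwise change of variables formula, given the a priori bounds on the increments of the
integrands and on the first order Taylor remainder along the path. -/
theorem exists_hasGLSIntegral_and_eq_add_sum {n : ℕ} {T : ℝ} (hT : 0 < T) {α : Fin n → ℝ} {α₀ : ℝ}
    (hα₀ : 1 / 2 < α₀) (hα : ∀ k, α₀ ≤ α k) (hadm : ∀ β, β < 1 → (∀ j, β < α j) → β < α₀)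
    {x x' : ℝ → Fin n → ℝ} (hxx' : ∀ t ∈ Icc 0 T, x t = x' t) {H : Fin n → ℝ} (hH : ∀ i, 0 ≤ H i)
    (hxH : ∀ i s t, |x s i - x t i| ≤ H i * |s - t| ^ α i) {N : ℝ} (hN : 0 ≤ N)
    (hxN : ∀ s i, x s i ∈ Icc (-N) N) (hxw : ∀ s t i, |x s i - x t i| ≤ N * |s - t| ^ α₀)
    {f : (Fin n → ℝ) → ℝ} (hf : Continuous f) {df : Fin n → (Fin n → ℝ) → ℝ}
    (hdf : ∀ k x, HasLeftPartialDeriv f k x (df k x)) (hbv : ∀ k, LocallyBVInEachVariable (df k))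
    (hfin : ∀ (k : Fin n) (m : ℕ), ∫⁻ s in Ioo 0 T, ∫⁻ u in Ioo 0 T, (if u < s then
      (windowSet n N (N * (s - u) ^ α₀)).indicator (fun p => ENNReal.ofReal |df k p.1 - df k p.2|)
        (x s, x u) * ENNReal.ofReal ((s - u) ^ (-(1 + (α₀ - 1 / ((m : ℝ) + 1))))) else 0) < ∞)
    (hlim : Tendsto (fun m : ℕ => ∫⁻ s in Ioo 0 T,
      (windowSet n N (N * ((1 / 2 : ℝ) ^ m) ^ α₀)).indicator (fun p => ENNReal.ofReal
        |f p.2 - f p.1 - ∑ k, df k p.1 * (p.2 k - p.1 k)|)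
        (x s, x (s + (1 / 2 : ℝ) ^ m)) * ENNReal.ofReal (((1 / 2 : ℝ) ^ m)⁻¹)) atTop (𝓝 0)) :
    ∃ I : Fin n → ℝ,
      (∀ k, ∀ β : ℝ, 0 < β → β < 1 → 1 - α k < β → (∀ j, β < α j) →
        HasGLSIntegral T β (fun t => df k (x' t)) (fun t => x' t k) (I k)) ∧
      f (x' T) = f (x' 0) + ∑ k, I k := by
  have hdm : ∀ k, Measurable (df k) := fun k => measurable_of_hasLeftPartialDeriv hf (hdf k)
  have hαpos : ∀ k, 0 < α k := fun k => by linarith [hα k]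
  have hxc : Continuous x := continuous_pi fun i =>
    continuous_of_abs_sub_le_rpow (hαpos i) (hxH i)
  have hxi : ∀ i, Continuous fun t => x t i := fun i => (continuous_apply i).comp hxc
  have hgm : ∀ k, Measurable fun t => df k (x t) := fun k => (hdm k).comp hxc.measurable
  choose B hB using fun k => (hbv k).exists_bound hN
  have hxwin : ∀ s u, u < s → (x s, x u) ∈ windowSet n N (N * (s - u) ^ α₀) := by
    intro s u hus i
    refine ⟨hxN s i, hxN u i, ?_⟩
    have := hxw s u i
    rwa [abs_of_pos (sub_pos.2 hus)] at this
  have hmem : ∀ k β, β < 1 → (∀ j, β < α j) → MemBesovTwo T β (fun t => df k (x t)) := by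
    intro k β hβ1 hβ
    obtain ⟨m, hm⟩ := exists_nat_one_div_lt (sub_pos.2 (hadm β hβ1 hβ))
    exact memBesovTwo_of_lintegral_lt_top hT.le hβ1 (by linarith) (hgm k)
      (fun t => hB k _ (hxN t)) hxwin (hfin k m)
  let δ : ℕ → ℝ := fun m => (1 / 2 : ℝ) ^ m
  have hδ : ∀ m, 0 < δ m := fun m => by positivity
  have hδlim : Tendsto δ atTop (𝓝 0) :=
    tendsto_pow_atTop_nhds_zero_of_lt_one (by norm_num) (by norm_num)
  have hfwd : ∀ k β, 0 < β → β < 1 → 1 - α k < β → (∀ j, β < α j) →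
      Tendsto (fun m => ∫ s in 0..T, df k (x s) * ((x (s + δ m) k - x s k) / δ m)) atTop
        (𝓝 (glsIntegral T β (fun t => df k (x t)) (fun t => x t k))) := by
    intro k β hβ0 hβ1 hβk hβ
    exact (hmem k β hβ1 hβ).tendsto_forwardIntegral hβ0 hβ1 hT (by linarith : 1 - β < α k) (hH k)
      (hgm k) (hxH k) ⟨N, fun s => abs_le.2 (hxN s k)⟩ hδ hδlim
  -- All orders exceed 1/2, so β = 1/2 is admissible for every k at once and can define the
  -- reference values.
  have hhalf : ∀ k, (1 - α k < 1 / 2) ∧ ∀ j, (1 / 2 : ℝ) < α j := fun k =>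
    ⟨by linarith [hα k], fun j => by linarith [hα j]⟩
  have hfwd2 := fun k => hfwd k (1 / 2) (by norm_num) (by norm_num) (hhalf k).1 (hhalf k).2
  refine ⟨fun k => glsIntegral T (1 / 2) (fun t => df k (x t)) (fun t => x t k), ?_, ?_⟩
  · intro k β hβ0 hβ1 hβk hβ
    dsimp only
    -- The same forward integrals converge to the value at 1/2 and to the value at β.
    rw [tendsto_nhds_unique (hfwd2 k) (hfwd k β hβ0 hβ1 hβk hβ)]
    exact HasGLSIntegral.of_holder hβ0 hβ1 hT (by linarith : 1 - β < α k) (hH k) (hgm k)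
      (hmem k β hβ1 hβ) (hxH k) (fun t ht => by simp only [hxx' t ht])
      (fun t ht => by simp only [hxx' t ht])
  · have hφ : Continuous fun t => f (x t) := hf.comp hxc
    have hF := tendsto_integral_forward_difference (T := T) hφ hδ hδlim
    have hS := tendsto_finsetSum Finset.univ fun k _ => hfwd2 k
    have hint : ∀ k m, IntervalIntegrable
        (fun s => df k (x s) * ((x (s + δ m) k - x s k) / δ m)) volume 0 T := by
      intro k m
      refine ((hmem k (1 / 2) (by norm_num) (hhalf k).2).intervalIntegrable hT.le (by norm_num)
        (hgm k)).mul_continuousOn (Continuous.continuousOn ?_)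
      have := hxi k
      fun_prop
    -- The path lies in every window, so the indicator in `hlim` is 1 and `hlim` dominates the
    -- averaged Taylor remainder.
    have hzero : Tendsto (fun m => (∫ s in 0..T, (f (x (s + δ m)) - f (x s)) / δ m) -
        ∑ k, ∫ s in 0..T, df k (x s) * ((x (s + δ m) k - x s k) / δ m)) atTop (𝓝 0) := by
      rw [tendsto_zero_iff_enorm_tendsto_zero]
      refine tendsto_of_tendsto_of_tendsto_of_le_of_le tendsto_const_nhds hlim
        (fun _ => zero_le) fun m => ?_
      dsimp only
      have hi1 : IntervalIntegrable (fun s => (f (x (s + δ m)) - f (x s)) / δ m) volume 0 T :=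
        Continuous.intervalIntegrable (by fun_prop) _ _
      have hi2 : IntervalIntegrable
          (fun s => ∑ k, df k (x s) * ((x (s + δ m) k - x s k) / δ m)) volume 0 T := by
        simpa only [Finset.sum_fn] using
          IntervalIntegrable.sum Finset.univ (fun k _ => hint k m)
      rw [← intervalIntegral.integral_finsetSum fun k _ => hint k m,
        ← intervalIntegral.integral_sub hi1 hi2,
        intervalIntegral_eq_setIntegral_Ioo hT.le]
      refine (enorm_integral_le_lintegral_enorm _).trans (lintegral_mono fun s => ?_)
      have hw : (x s, x (s + δ m)) ∈ windowSet n N (N * (δ m) ^ α₀) := by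
        intro i
        refine ⟨hxN s i, hxN _ i, ?_⟩
        have := hxw s (s + δ m) i
        rwa [sub_add_cancel_left, abs_neg, abs_of_pos (hδ m)] at this
      rw [indicator_of_mem hw, ← ENNReal.ofReal_mul (abs_nonneg _), Real.enorm_eq_ofReal_abs]
      refine ENNReal.ofReal_le_ofReal (le_of_eq ?_)
      change _ = _ * (δ m)⁻¹
      rw [← abs_of_pos (inv_pos.2 (hδ m)), ← abs_mul, sub_mul, Finset.sum_mul]
      congr 2
      refine Finset.sum_congr rfl fun k _ => ?_
      rw [div_eq_mul_inv, mul_assoc]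
    have h1 := tendsto_nhds_unique hzero (hF.sub hS)
    rw [← hxx' T ⟨hT.le, le_rfl⟩, ← hxx' 0 ⟨le_rfl, hT.le⟩]
    linarith

/-! ### Choice of exponents and constants, and conclusion. -/

/-- The minimum of 1 and all α_k; adjoining `none` with value 1 also covers n = 0. -/
theorem exists_common_exponent {n : ℕ} {α : Fin n → ℝ} (hα : ∀ k, 1 / 2 < α k) :
    ∃ α₀ : ℝ, 1 / 2 < α₀ ∧ (∀ k, α₀ ≤ α k) ∧ ∀ β, β < 1 → (∀ j, β < α j) → β < α₀ := by
  obtain ⟨o, -, ho⟩ := Finset.exists_min_image (Finset.univ : Finset (Option (Fin n)))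
    (fun o => o.elim 1 α) ⟨none, Finset.mem_univ _⟩
  refine ⟨o.elim 1 α, ?_, fun k => ho (some k) (Finset.mem_univ _), fun β h1 hβ => ?_⟩
  · cases o with
    | none => norm_num
    | some k => exact hα k
  · cases o with
    | none => exact h1
    | some k => exact hβ k

theorem HolderOnWith.abs_sub_le {C r : ℝ≥0} {g : ℝ → ℝ} {s : Set ℝ} (hg : HolderOnWith C r g s)
    {u v : ℝ} (hu : u ∈ s) (hv : v ∈ s) : |g u - g v| ≤ C * |u - v| ^ (r : ℝ) := by
  have h := hg u hu v hv
  rw [edist_dist, edist_dist, Real.dist_eq, Real.dist_eq,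
    ENNReal.ofReal_rpow_of_nonneg (abs_nonneg _) r.coe_nonneg, ← ENNReal.ofReal_coe_nnreal,
    ← ENNReal.ofReal_mul C.coe_nonneg, ENNReal.ofReal_le_ofReal_iff (by positivity)] at h
  exact h

theorem abs_clamp_sub_clamp_le (T s t : ℝ) :
    |max 0 (min s T) - max 0 (min t T)| ≤ |s - t| := by
  refine (abs_max_sub_max_le_max _ _ _ _).trans ?_
  simp only [sub_self, abs_zero]
  refine max_le (abs_nonneg _) ((abs_min_sub_min_le_max _ _ _ _).trans ?_)
  simp

/-- Multidimensional Itô formula: the stochastic integrals exist almost surely, with a value that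
does not depend on the exponent `β`, and the change of variables formula holds. -/
theorem theorem3p8 {Ω : Type*} [MeasurableSpace Ω] (P : Measure Ω) [IsProbabilityMeasure P]
    (n : ℕ) (T : ℝ) (hT : 0 < T) (α : Fin n → ℝ≥0) (hα : ∀ k, (1 / 2 : ℝ) < α k)
    (X : Fin n → ℝ → Ω → ℝ)
    (hX_meas : ∀ k, ∀ t ∈ Set.Icc 0 T, Measurable (X k t))
    (hX_indep : iIndepFun (fun k ω (t : Set.Icc (0 : ℝ) T) => X k t ω) P)
    (hX_holder : ∀ k, ∀ᵐ ω ∂P, ∃ C : ℝ≥0,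
      HolderOnWith C (α k) (fun t => X k t ω) (Set.Icc 0 T))
    (hX_density : ∀ k, HasIntegrablyBoundedDensities P T (X k))
    (f : (Fin n → ℝ) → ℝ) (df : Fin n → (Fin n → ℝ) → ℝ)
    (hf_cont : ∀ (k : Fin n) (x : Fin n → ℝ), Continuous fun u => f (Function.update x k u))
    (hdf : ∀ k x, HasLeftPartialDeriv f k x (df k x))
    (hdf_bv : ∀ k, LocallyBVInEachVariable (df k)) :
    ∀ᵐ ω ∂P, ∃ I : Fin n → ℝ,
      (∀ k, ∀ β : ℝ, 0 < β → β < 1 → 1 - α k < β → (∀ j, β < α j) →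
        HasGLSIntegral T β (fun t => df k (fun i => X i t ω)) (fun t => X k t ω) (I k)) ∧
      f (fun i => X i T ω) = f (fun i => X i 0 ω) + ∑ k, I k := by
  have hf := continuous_of_hasLeftPartialDeriv hf_cont hdf hdf_bv
  obtain ⟨α₀, hα₀, hα₀le, hadm⟩ := exists_common_exponent hα
  obtain ⟨c, hc, hci⟩ := exists_density_bounds hX_density
  have hcont : ∀ k, ∀ᵐ ω ∂P, ContinuousOn (fun t => X k t ω) (Icc 0 T) := by
    intro k
    filter_upwards [hX_holder k] with ω ⟨C, hC⟩
    exact hC.continuousOn (by have := hα k; exact_mod_cast (by linarith : (0 : ℝ) < α k))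
  obtain ⟨Y, hY, hYX⟩ := exists_measurable_modification hT.le hX_meas hcont
  -- One null set for all k, m and N, so that N may afterwards be chosen depending on the path.
  have hfin : ∀ᵐ ω ∂P, ∀ (k : Fin n) (m N : ℕ), _ := ae_all_iff.2 fun k => ae_all_iff.2 fun m =>
    ae_all_iff.2 fun N => ae_lintegral_increment_lt_top hX_meas hX_indep hc hci hY hYX
      (sub_lt_self α₀ (Nat.one_div_pos_of_nat (n := m))) N.cast_nonneg
      (measurable_of_hasLeftPartialDeriv hf (hdf k)) (hdf_bv k)
  have hlim : ∀ᵐ ω ∂P, ∀ N : ℕ, _ := ae_all_iff.2 fun N => ae_tendsto_lintegral_taylor hX_meas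
    hX_indep hc hci hT.le hY hYX hα₀ N.cast_nonneg hf hdf hdf_bv
  filter_upwards [ae_all_iff.2 hX_holder, hYX, hfin, hlim] with ω hhol hω hfinω hlimω
  choose H hH using hhol
  have hclamp : ∀ t, max 0 (min t T) ∈ Icc 0 T := fun t =>
    ⟨le_max_left _ _, max_le hT.le (min_le_right _ _)⟩
  have hYH : ∀ i s t, |Y s ω i - Y t ω i| ≤
      H i * |max 0 (min s T) - max 0 (min t T)| ^ (α i : ℝ) := fun i s t => by
    rw [hω, hω]; exact (hH i).abs_sub_le (hclamp s) (hclamp t)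
  have hdT : ∀ s t, |max 0 (min s T) - max 0 (min t T)| ≤ T := fun s t => by
    rw [abs_le]; constructor <;> linarith [(hclamp s).1, (hclamp s).2, (hclamp t).1, (hclamp t).2]
  -- The first two summands bound the i-th coordinate of the path. The third lowers the Hölder order
  -- from α_i to α₀: clamped times differ by d ≤ T, hence d^(α_i) ≤ T^(α_i-α₀) d^(α₀).
  let M : Fin n → ℝ := fun i => |Y 0 ω i| + H i * T ^ (α i : ℝ) + H i * T ^ ((α i : ℝ) - α₀)
  have hM0 : ∀ i, 0 ≤ M i := fun i => by positivity
  obtain ⟨N, hN⟩ := exists_nat_ge (∑ i, M i)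
  have hMN : ∀ i, M i ≤ N := fun i =>
    (Finset.single_le_sum (fun j _ => hM0 j) (Finset.mem_univ i)).trans hN
  refine exists_hasGLSIntegral_and_eq_add_sum hT hα₀ hα₀le hadm (x := fun t => Y t ω)
    (x' := fun t i => X i t ω) (H := fun i => H i) (N := N) (fun t ht => ?_) (fun i => (H i).2)
    (fun i s t => ?_) N.cast_nonneg (fun s i => ?_) (fun s t i => ?_) hf hdf hdf_bv
    (fun k m => hfinω k m N) (hlimω N)
  · ext i; rw [hω, min_eq_left ht.2, max_eq_right ht.1]
  · refine (hYH i s t).trans ?_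
    have := abs_clamp_sub_clamp_le T s t
    gcongr
  · rw [mem_Icc, ← abs_le]
    have h1 := hYH i s 0
    have h2 : (H i : ℝ) * |max 0 (min s T) - max 0 (min 0 T)| ^ (α i : ℝ) ≤ H i * T ^ (α i : ℝ) := by
      have := hdT s 0
      gcongr
    have h3 : 0 ≤ (H i : ℝ) * T ^ ((α i : ℝ) - α₀) := by positivity
    have h4 := abs_sub_abs_le_abs_sub (Y s ω i) (Y 0 ω i)
    have h5 : M i ≤ N := hMN i
    simp only [M] at h5
    linarith
  · refine (hYH i s t).trans ?_
    have h5 : M i ≤ N := hMN i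
    have h6 : (H i : ℝ) * T ^ ((α i : ℝ) - α₀) ≤ N := le_trans (by
      simp only [M]
      have : 0 ≤ |Y 0 ω i| + H i * T ^ (α i : ℝ) := by positivity
      linarith) h5
    set d := |max 0 (min s T) - max 0 (min t T)| with hd
    have hd0 : 0 ≤ d := abs_nonneg _
    have h7 : d ^ (α i : ℝ) = d ^ ((α i : ℝ) - α₀) * d ^ α₀ := by
      rw [← Real.rpow_add_of_nonneg hd0 (sub_nonneg.2 (hα₀le i)) (by linarith), sub_add_cancel]
    have h8 := abs_clamp_sub_clamp_le T s t
    have h9 := hdT s t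
    have h10 : 0 ≤ (α i : ℝ) - α₀ := sub_nonneg.2 (hα₀le i)
    rw [h7, ← mul_assoc]
    calc _ ≤ ((H i : ℝ) * T ^ ((α i : ℝ) - α₀)) * |s - t| ^ α₀ := by gcongr
      _ ≤ _ := by gcongr
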